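/- **Definitions.** A *Lorentzian pre-length space* $(X,d,\ll,\le,\tau)$ is a set with a metric $d$ (values in $[0,\infty]$), a reflexive and transitive relation $\le$, a transitive relation $\ll$ contained in $\le$, and a function $\tau:X\times X\to[0,\infty]$ that is lower semicontinuous with respect to $d$, such that $\tau(x,y)+\tau(y,z)\le\tau(x,z)$ whenever $x\le y\le z$, and $\tau(x,y)>0\iff x\ll y$. Put $I^+(x)=\{y: x\ll y\}$, $I^-(x)=\{y:y\ll x\}$, $I(x,y)=I^+(x)\cap I^-(y)$, and $J^\pm(x)$, $J(x,y)$ likewise with $\le$. A *causal* (*timelike*) curve is a locally Lipschitz map $\gamma:[a,b]\to X$, $a<b$, with $\gamma(s)\le\gamma(t)$ (resp. $\gamma(s)\ll\gamma(t)$) for all $s<t$; $L_d(\gamma)$ is its metric length. A subset $A\subseteq X$ is *non-timelike locally isolating* if for every $a\in A$ with $I^{+}(a)\ne\emptyset$ every neighbourhood of $a$ contains some $b\in A$ with $a\ll b$, and for every $a\in A$ with $I^-(a)\neq\emptyset$ every neighbourhood of $a$ contains some $b\in A$ with $b\ll a$. $A$ is *time observing* if for all $x\in X$ there are $a_-,a_+\in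 A$ with $J^+(x)\cap A\subseteq J^+(a_-)$ and $J^-(x)\cap A\subseteq J^-(a_+)$. The space $X$ - is *chronological* if $x\not\ll x$ for all $x$; *causal* if $\le$ is antisymmetric; - is *non-totally imprisoning* if for every compact $B\subseteq X$ there is $C>0$ with $L_d(\gamma)\le C$ for all causal curves $\gamma$ in $B$; *extrinsically non-totally imprisoning* if for every compact $K\subseteq X$ there is $C>0$ with $\sum_{i<n} d(x_i,x_{i+1})\le C$ for all finite sequences $x_1\le x_2\le\dots\le x_n$ in $K$; - is *strongly causal* if the sets $I(x,y)$, $x,y\in X$, form a subbasis of the metric topology (that is, they cover $X$ and generate the topology); - is *distinguishing* if $I^+(x)=I^+(y)$ implies $x=y$ and $I^-(x)=I^-(y)$ implies $x=y$; - *has no $\ll$-isolated points* if $I^+(x)\ne\emptyset\neq I^-(x)$ for all $x$; - is *causally path-connected* if $x\ll y$ (resp. $x\le y$) implies that there is a timelike (resp. causal) curve from $x$ to $y$; - is *locally causally closed* if every point has a neighbourhood $U$ such that $p_n\le q_n$, $p_n,q_n\in U$, $p_n\to p\in\overline U$, $q_n\to q\in\overline U$ imply $p\le q$; - is *$d$-compatible*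 if every point has a neighbourhood $U$ and a $C>0$ with $L_d(\gamma)\le C$ for all causal curves $\gamma$ in $U$; - is *globally hyperbolic* if it is non-totally imprisoning and all $J(x,y)$ are compact. Let $X_1,X_2$ be Lorentzian pre-length spaces, $A_i\subseteq X_i$ closed and non-timelike locally isolating, and $f:A_1\to A_2$ a homeomorphism that is locally bi-Lipschitz (every $a\in A_1$ has a neighbourhood $U$ in $A_1$ such that $f|_U:U\to f(U)$ and its inverse are Lipschitz), with $I^\pm(a)\ne\emptyset\iff I^\pm(f(a))\ne\emptyset$, $\tau(a,b)=\tau(f(a),f(b))$ and $a\le b\iff f(a)\le f(b)$ for all $a,b\in A_1$. On the disjoint union $X_1\sqcup X_2$, points of different components have distance $\infty$, are unrelated, and have $\tau=0$. The *Lorentzian amalgamation* $X=X_1\sqcup_A X_2$ is the quotient of $X_1\sqcup X_2$ by the equivalence relation $\sim$ generated by $a\sim f(a)$, $a\in A_1$, with $$\tilde\tau([x],[y])=\sup\Big\{\sum_{i=1}^n\tau(x_i,y_i)\;:\; x\sim x_1\le y_1\sim x_2\le y_2\sim\dots\sim x_n\le y_n\sim y,\ n\ge 1\Big\}\qquad(\sup\emptyset=0),$$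 $[x]\,\tilde\le\,[y]$ iff such a chain exists, $[x]\,\tilde\ll\,[y]$ iff $\tilde\tau([x],[y])>0$, and $\tilde d([x],[y])=\inf\sum_{i=1}^n d(x_i,y_i)$ over all $x\sim x_1$, $y_i\sim x_{i+1}$, $y_n\sim y$, $n\ge1$. **Theorem (Causal inheritance).** In this situation: 1. If $X_1$ and $X_2$ are chronological, then so is $X$. 2. If $X_1$ and $X_2$ are causal, then so is $X$. 3. If $X_1$ and $X_2$ are extrinsically non-totally imprisoning, then $X$ is non-totally imprisoning. 4. If $X_1$ and $X_2$ are strongly causal and non-timelike locally isolating (as subsets of themselves), then $X$ is strongly causal. 5. If $X_1$ and $X_2$ are strongly causal, non-timelike locally isolating and distinguishing, then $X$ is distinguishing. 6. If $X_1$ and $X_2$ are causally path-connected, locally causally closed, $d$-compatible and globally hyperbolic and have no $\ll$-isolated points, and if $A_1$ and $A_2$ are time observing, then $X$ is globally hyperbolic. -/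

import Mathlib

open Set Filter Topology
open scoped ENNReal NNReal

namespace Lorentz

universe u v

/-! ### Lorentzian pre-length spaces -/

/-- The data `(X, d, ≪, ≤, τ)`. The distance `d` (written `edist`) takes values in `[0, ∞]`;
`Chron x y` is the timelike relation `x ≪ y`, `Caus x y` is the causal relation `x ≤ y`, and
`tau` is the time separation. No axioms are imposed on `Chron`, `Caus`, `tau` here; topological
notions refer to the topology induced by `d`. -/
class LorentzStructure (X : Type u) extends PseudoEMetricSpace X where
  Chron : X → X → Prop
  Caus : X → X → Prop
  tau : X → X → ℝ≥0∞

/-- A Lorentzian pre-length space. -/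
class PreLengthSpace (X : Type u) extends LorentzStructure X where
  eq_of_edist_eq_zero : ∀ x y : X, edist x y = 0 → x = y
  caus_refl : ∀ x : X, Caus x x
  caus_trans : ∀ x y z : X, Caus x y → Caus y z → Caus x z
  chron_trans : ∀ x y z : X, Chron x y → Chron y z → Chron x z
  chron_caus : ∀ x y : X, Chron x y → Caus x y
  tau_lsc : LowerSemicontinuous (fun p : X × X => tau p.1 p.2)
  tau_triangle : ∀ x y z : X, Caus x y → Caus y z → tau x y + tau y z ≤ tau x z
  tau_pos_iff : ∀ x y : X, 0 < tau x y ↔ Chron x y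

open LorentzStructure

section Notions

variable {X : Type u} [LorentzStructure X]

/-- The timelike future `I⁺(x)`. -/
def chronFuture (x : X) : Set X := {y | Chron x y}

/-- The timelike past `I⁻(x)`. -/
def chronPast (x : X) : Set X := {y | Chron y x}

/-- The causal future `J⁺(x)`. -/
def causFuture (x : X) : Set X := {y | Caus x y}

/-- The causal past `J⁻(x)`. -/
def causPast (x : X) : Set X := {y | Caus y x}

/-- The timelike diamond `I(x, y)`. -/
def chronDiamond (x y : X) : Set X := chronFuture x ∩ chronPast y

/-- The causal diamond `J(x, y)`. -/
def causDiamond (x y : X) : Set X := causFuture x ∩ causPast y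

/-- `γ : [a, b] → X` is a (future-directed) causal curve. -/
def IsCausalCurve (γ : ℝ → X) (a b : ℝ) : Prop :=
  a < b ∧ LocallyLipschitzOn (Icc a b) γ ∧
    ∀ s ∈ Icc a b, ∀ t ∈ Icc a b, s < t → Caus (γ s) (γ t)

/-- `γ : [a, b] → X` is a (future-directed) timelike curve. -/
def IsTimelikeCurve (γ : ℝ → X) (a b : ℝ) : Prop :=
  a < b ∧ LocallyLipschitzOn (Icc a b) γ ∧
    ∀ s ∈ Icc a b, ∀ t ∈ Icc a b, s < t → Chron (γ s) (γ t)

/-- The metric length `L_d(γ)` of `γ : [a, b] → X`. -/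
noncomputable def curveLength (γ : ℝ → X) (a b : ℝ) : ℝ≥0∞ := eVariationOn γ (Icc a b)

/-- `A` is a non-future locally isolating subset. -/
def NonFutureLocallyIsolating (A : Set X) : Prop :=
  ∀ a ∈ A, (chronFuture a).Nonempty → ∀ U ∈ 𝓝 a, ∃ b ∈ U ∩ A, Chron a b

/-- `A` is a non-past locally isolating subset. -/
def NonPastLocallyIsolating (A : Set X) : Prop :=
  ∀ a ∈ A, (chronPast a).Nonempty → ∀ U ∈ 𝓝 a, ∃ b ∈ U ∩ A, Chron b a

/-- `A` is a non-timelike locally isolating subset. -/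
def NonTimelikeLocallyIsolating (A : Set X) : Prop :=
  NonFutureLocallyIsolating A ∧ NonPastLocallyIsolating A

/-- Every causal future (past) of a point meets `A` inside the future (past) of a point of `A`. -/
def TimeObserving (A : Set X) : Prop :=
  (∀ x : X, ∃ a ∈ A, causFuture x ∩ A ⊆ causFuture a ∩ A) ∧
    ∀ x : X, ∃ a ∈ A, causPast x ∩ A ⊆ causPast a ∩ A

/-- `U` is causally closed. -/
def CausallyClosed (U : Set X) : Prop :=
  ∀ (p q : ℕ → X) (p' q' : X), (∀ n, p n ∈ U) → (∀ n, q n ∈ U) → (∀ n, Caus (p n) (q n)) →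
    p' ∈ closure U → q' ∈ closure U → Tendsto p atTop (𝓝 p') → Tendsto q atTop (𝓝 q') →
    Caus p' q'

end Notions

section Ladder

variable (X : Type u) [LorentzStructure X]

/-- There are no `≪`-isolated points. -/
def NoChronIsolatedPoints : Prop :=
  ∀ x : X, (chronFuture x).Nonempty ∧ (chronPast x).Nonempty

def Chronological : Prop := ∀ x : X, ¬ Chron x x

def Causal : Prop := ∀ x y : X, Caus x y → Caus y x → x = y

def NonTotallyImprisoning : Prop :=
  ∀ B : Set X, IsCompact B → ∃ C : ℝ≥0, 0 < C ∧
    ∀ (γ : ℝ → X) (a b : ℝ), IsCausalCurve γ a b → (∀ t ∈ Icc a b, γ t ∈ B) →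
      curveLength γ a b ≤ C

/-- Uniform bound for the `d`-length of the finite causal sequences `x 0 ≤ x 1 ≤ ⋯ ≤ x n` in a
compact set. -/
def ExtrinsicallyNonTotallyImprisoning : Prop :=
  ∀ K : Set X, IsCompact K → ∃ C : ℝ≥0, 0 < C ∧
    ∀ (n : ℕ) (x : ℕ → X), (∀ i ≤ n, x i ∈ K) → (∀ i < n, Caus (x i) (x (i + 1))) →
      ∑ i ∈ Finset.range n, edist (x i) (x (i + 1)) ≤ C

/-- The timelike diamonds form a subbasis of the metric topology: they cover the space, and they
generate the topology. -/
def StronglyCausal : Prop :=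
  (⋃ p : X × X, chronDiamond p.1 p.2) = univ ∧
    (inferInstance : TopologicalSpace X) =
      TopologicalSpace.generateFrom {D : Set X | ∃ x y : X, D = chronDiamond x y}

/-- Future distinguishing and past distinguishing. -/
def Distinguishing : Prop :=
  (∀ x y : X, chronFuture x = chronFuture y → x = y) ∧
    ∀ x y : X, chronPast x = chronPast y → x = y

def CausallyPathConnected : Prop :=
  (∀ x y : X, Chron x y → ∃ (γ : ℝ → X) (a b : ℝ), IsTimelikeCurve γ a b ∧ γ a = x ∧ γ b = y) ∧
    ∀ x y : X, Caus x y → ∃ (γ : ℝ → X) (a b : ℝ), IsCausalCurve γ a b ∧ γ a = x ∧ γ b = y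

def LocallyCausallyClosed : Prop := ∀ x : X, ∃ U ∈ 𝓝 x, CausallyClosed U

/-- `d`-compatibility. -/
def DCompatible : Prop :=
  ∀ x : X, ∃ U ∈ 𝓝 x, ∃ C : ℝ≥0, 0 < C ∧
    ∀ (γ : ℝ → X) (a b : ℝ), IsCausalCurve γ a b → (∀ t ∈ Icc a b, γ t ∈ U) →
      curveLength γ a b ≤ C

def GloballyHyperbolic : Prop :=
  NonTotallyImprisoning X ∧ ∀ x y : X, IsCompact (causDiamond x y)

end Ladder

/-! ### Quotients and amalgamation -/

section Quotients

/-- `QuotChain s R c p q r`: there is a chain `x₁, y₁, …, xₙ, yₙ` with `n ≥ 1`, `p = [x₁]`,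
`R xᵢ yᵢ`, `[yᵢ] = [xᵢ₊₁]`, `[yₙ] = q` and `r = ∑ᵢ c xᵢ yᵢ`. -/
inductive QuotChain {Y : Type u} (s : Setoid Y) (R : Y → Y → Prop) (c : Y → Y → ℝ≥0∞) :
    Quotient s → Quotient s → ℝ≥0∞ → Prop
  | single (x y : Y) (h : R x y) :
      QuotChain s R c (Quotient.mk s x) (Quotient.mk s y) (c x y)
  | cons (x y : Y) (h : R x y) (q : Quotient s) (r : ℝ≥0∞)
      (t : QuotChain s R c (Quotient.mk s y) q r) :
      QuotChain s R c (Quotient.mk s x) q (c x y + r)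

variable {Y : Type u} {s : Setoid Y} {R : Y → Y → Prop} {c : Y → Y → ℝ≥0∞}

theorem QuotChain.append {p q q' : Quotient s} {r r' : ℝ≥0∞} (h : QuotChain s R c p q r)
    (h' : QuotChain s R c q q' r') : QuotChain s R c p q' (r + r') := by
  induction h with
  | single x y hxy => exact QuotChain.cons x y hxy _ _ h'
  | cons x y hxy q r t ih =>
    rw [add_assoc]
    exact QuotChain.cons x y hxy _ _ (ih h')

theorem QuotChain.reverse (hR : ∀ x y, R x y → R y x) (hc : ∀ x y, c x y = c y x)
    {p q : Quotient s} {r : ℝ≥0∞} (h : QuotChain s R c p q r) : QuotChain s R c q p r := by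
  induction h with
  | single x y hxy =>
    rw [hc]
    exact QuotChain.single y x (hR _ _ hxy)
  | cons x y hxy q r t ih =>
    rw [add_comm, hc]
    exact ih.append (QuotChain.single y x (hR _ _ hxy))

/-- The quotient semi-metric: infimum of `∑ᵢ d(xᵢ, yᵢ)` over all chains. -/
noncomputable def quotDist (s : Setoid Y) (d : Y → Y → ℝ≥0∞) (p q : Quotient s) : ℝ≥0∞ :=
  sInf {r | QuotChain s (fun _ _ => True) d p q r}

/-- The quotient causal relation: there is a chain with `xᵢ ≤ yᵢ`. -/
def quotCaus (s : Setoid Y) (le : Y → Y → Prop) (t : Y → Y → ℝ≥0∞) (p q : Quotient s) : Prop :=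
  {r | QuotChain s le t p q r}.Nonempty

/-- The quotient time separation: supremum of `∑ᵢ τ(xᵢ, yᵢ)` over all chains with `xᵢ ≤ yᵢ`,
where the supremum of the empty set is `0`. -/
noncomputable def quotTau (s : Setoid Y) (le : Y → Y → Prop) (t : Y → Y → ℝ≥0∞)
    (p q : Quotient s) : ℝ≥0∞ :=
  sSup {r | QuotChain s le t p q r}

theorem quotDist_self {d : Y → Y → ℝ≥0∞} (hd : ∀ x, d x x = 0) (p : Quotient s) :
    quotDist s d p p = 0 := by
  induction p using Quotient.inductionOn with
  | h x =>
    refine le_antisymm (sInf_le ?_) (zero_le)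
    have h := QuotChain.single (s := s) (R := fun _ _ => True) (c := d) x x trivial
    rwa [hd] at h

theorem quotDist_comm {d : Y → Y → ℝ≥0∞} (hd : ∀ x y, d x y = d y x) (p q : Quotient s) :
    quotDist s d p q = quotDist s d q p := by
  have key : ∀ p q : Quotient s, quotDist s d p q ≤ quotDist s d q p := fun p q =>
    le_sInf fun _ hr => sInf_le (QuotChain.reverse (fun _ _ h => h) hd hr)
  exact le_antisymm (key p q) (key q p)

theorem quotDist_triangle {d : Y → Y → ℝ≥0∞} (p q q' : Quotient s) :
    quotDist s d p q' ≤ quotDist s d p q + quotDist s d q q' := by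
  simp only [quotDist]
  rw [ENNReal.sInf_add]
  refine le_iInf₂ fun r hr => ?_
  rw [add_comm, ENNReal.sInf_add]
  refine le_iInf₂ fun r' hr' => ?_
  rw [add_comm]
  exact sInf_le (QuotChain.append hr hr')

end Quotients

section Amalgamation

variable {X₁ : Type u} {X₂ : Type v}

/-- Distance of the disjoint union. -/
noncomputable def sumDist [LorentzStructure X₁] [LorentzStructure X₂] :
    X₁ ⊕ X₂ → X₁ ⊕ X₂ → ℝ≥0∞
  | .inl x, .inl y => edist x y
  | .inr x, .inr y => edist x y
  | _, _ => ⊤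

/-- Causal relation of the disjoint union. -/
def sumCaus [LorentzStructure X₁] [LorentzStructure X₂] : X₁ ⊕ X₂ → X₁ ⊕ X₂ → Prop
  | .inl x, .inl y => Caus x y
  | .inr x, .inr y => Caus x y
  | _, _ => False

/-- Time separation of the disjoint union. -/
def sumTau [LorentzStructure X₁] [LorentzStructure X₂] : X₁ ⊕ X₂ → X₁ ⊕ X₂ → ℝ≥0∞
  | .inl x, .inl y => tau x y
  | .inr x, .inr y => tau x y
  | _, _ => 0

/-- The equivalence relation on `X₁ ⊕ X₂` generated by `a ∼ f a` for `a ∈ A₁`. -/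
def glueSetoid {A₁ : Set X₁} {A₂ : Set X₂} (f : A₁ → A₂) : Setoid (X₁ ⊕ X₂) :=
  Relation.EqvGen.setoid fun p q =>
    ∃ a : A₁, p = Sum.inl (a : X₁) ∧ q = Sum.inr (f a : X₂)

/-- The underlying set of the amalgamation `X₁ ⊔_A X₂`. -/
def Amalgam {A₁ : Set X₁} {A₂ : Set X₂} (f : A₁ → A₂) : Type (max u v) :=
  Quotient (glueSetoid f)

/-- The amalgamation with the quotient of the disjoint union structure. -/
noncomputable instance instAmalgam [LorentzStructure X₁] [LorentzStructure X₂]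
    {A₁ : Set X₁} {A₂ : Set X₂} (f : A₁ → A₂) : LorentzStructure (Amalgam f) where
  edist := quotDist (glueSetoid f) sumDist
  edist_self := quotDist_self (by rintro (x | x) <;> simp [sumDist])
  edist_comm := quotDist_comm (by rintro (x | x) (y | y) <;> simp [sumDist, edist_comm])
  edist_triangle := quotDist_triangle
  Chron p q := 0 < quotTau (glueSetoid f) sumCaus sumTau p q
  Caus := quotCaus (glueSetoid f) sumCaus sumTau
  tau := quotTau (glueSetoid f) sumCaus sumTau

/-- `f` and its inverse are Lipschitz near every point of `A₁`. -/
def LocallyBiLipschitz [LorentzStructure X₁] [LorentzStructure X₂] {A₁ : Set X₁} {A₂ : Set X₂}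
    (f : A₁ ≃ₜ A₂) : Prop :=
  ∀ a : A₁, ∃ U ∈ 𝓝 a, (∃ K : ℝ≥0, LipschitzOnWith K f U) ∧
    ∃ K : ℝ≥0, LipschitzOnWith K f.symm (f '' U)

/-- Admissible gluing data: `A₁`, `A₂` are closed and non-timelike locally isolating, and
`f : A₁ → A₂` is a locally bi-Lipschitz homeomorphism with compatible causality that preserves
`τ` and `≤`. -/
structure GluingData [LorentzStructure X₁] [LorentzStructure X₂] (A₁ : Set X₁) (A₂ : Set X₂)
    (f : A₁ ≃ₜ A₂) : Prop where
  closed₁ : IsClosed A₁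
  closed₂ : IsClosed A₂
  isolating₁ : NonTimelikeLocallyIsolating A₁
  isolating₂ : NonTimelikeLocallyIsolating A₂
  biLipschitz : LocallyBiLipschitz f
  future_iff : ∀ a : A₁, (chronFuture (a : X₁)).Nonempty ↔ (chronFuture (f a : X₂)).Nonempty
  past_iff : ∀ a : A₁, (chronPast (a : X₁)).Nonempty ↔ (chronPast (f a : X₂)).Nonempty
  tau_eq : ∀ a b : A₁, tau (a : X₁) (b : X₁) = tau (f a : X₂) (f b : X₂)
  caus_iff : ∀ a b : A₁, Caus (a : X₁) (b : X₁) ↔ Caus (f a : X₂) (f b : X₂)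

end Amalgamation

end Lorentz

namespace Lorentz

universe u v w

open LorentzStructure PreLengthSpace

/-! ### Basic facts on pre-length spaces -/

section Basic

variable {X : Type u} [PreLengthSpace X]

/-! Since `f` preserves `≤` and `τ` on the glued set `A`, a chain in the amalgamation that leaves a
component and returns can have its excursion moved into that component, and the reverse triangle
inequality merges the pieces without loss of length. So every chain reduces to one with at most one
crossing. Hence each component keeps its own `≤` and `≪`, and a mixed relation factors through a
point of `A`. For `≪` both factors can be made timelike because `A` is non-timelike locally
isolating. On the metric side, bi-Lipschitz control near `A` shows that the quotient metric induces
the quotient topology, so both components are closed subspaces. `CausalGluing` records these facts,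
and all six claims follow from it.

Chronology and causality reduce to the components. For strong causality and distinction, a small
diamond around a point off `A` cannot see the other component, since a relation to it would pass
through a point of `A` inside the diamond; at a point of `A`, diamonds with vertices in `A` are
controlled by both components at once.

For imprisonment, each component contributes a potential: the supremal length of causal chains in
the compact set that end in the past of a given point. The sum of the two potentials grows along a
causal curve at least as fast as its length, and it is bounded by extrinsic non-total imprisonment.

For global hyperbolicity, the components are extrinsically non-totally imprisoning (join causal
sequences by curves) and have closed causal relations (subdivide curves and pass to limits). Time
observation encloses the trace of a diamond on each component in a compact diamond there, and a
limit argument at the mediating points in `A` shows that the diamond is closed. -/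

instance : T0Space X :=
  ⟨fun x y h => eq_of_edist_eq_zero x y (EMetric.inseparable_iff.1 h)⟩

theorem chron_caus_trans {x y z : X} (h : Chron x y) (h' : Caus y z) : Chron x z := by
  rw [← tau_pos_iff] at h ⊢
  exact h.trans_le (le_self_add.trans
    (tau_triangle x y z (chron_caus _ _ ((tau_pos_iff _ _).1 h)) h'))

theorem caus_chron_trans {x y z : X} (h : Caus x y) (h' : Chron y z) : Chron x z := by
  rw [← tau_pos_iff] at h' ⊢
  exact h'.trans_le (le_add_self.trans
    (tau_triangle x y z h (chron_caus _ _ ((tau_pos_iff _ _).1 h'))))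

theorem isOpen_chronFuture (x : X) : IsOpen (chronFuture x) := by
  have h := (tau_lsc (X := X)).isOpen_preimage 0
  have h' := h.preimage (Continuous.prodMk_right x)
  convert h' using 1
  ext y
  simp [chronFuture, ← tau_pos_iff]

theorem isOpen_chronPast (x : X) : IsOpen (chronPast x) := by
  have h := (tau_lsc (X := X)).isOpen_preimage 0
  have h' := h.preimage (Continuous.prodMk_left x)
  convert h' using 1
  ext y
  simp [chronPast, ← tau_pos_iff]

theorem isOpen_chronDiamond (x y : X) : IsOpen (chronDiamond x y) :=
  (isOpen_chronFuture x).inter (isOpen_chronPast y)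

theorem chronDiamond_mono {x x' y y' : X} (hx : Chron x x') (hy : Chron y' y) :
    chronDiamond x' y' ⊆ chronDiamond x y := fun _ hz =>
  ⟨chron_trans _ _ _ hx hz.1, chron_trans _ _ _ hz.2 hy⟩

theorem StronglyCausal.noChronIsolatedPoints (h : StronglyCausal X) : NoChronIsolatedPoints X := by
  intro x
  have hx : x ∈ ⋃ p : X × X, chronDiamond p.1 p.2 := h.1 ▸ mem_univ x
  obtain ⟨p, hp⟩ := mem_iUnion.1 hx
  exact ⟨⟨p.2, hp.2⟩, ⟨p.1, hp.1⟩⟩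

/-- In a strongly causal space without locally isolated points, the timelike diamonds form a
neighbourhood basis. -/
theorem StronglyCausal.exists_chronDiamond_subset (h : StronglyCausal X)
    (hX : NonTimelikeLocallyIsolating (univ : Set X)) {x : X} {U : Set X} (hU : U ∈ 𝓝 x) :
    ∃ y z, x ∈ chronDiamond y z ∧ chronDiamond y z ⊆ U := by
  let S : Set (Set X) := {D | ∃ x y : X, D = chronDiamond x y}
  have hb := TopologicalSpace.isTopologicalBasis_of_subbasis (s := S) h.2
  obtain ⟨V, ⟨F, ⟨hF, hFS⟩, rfl⟩, hxV, hVU⟩ := hb.mem_nhds_iff.1 hU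
  have hV : ⋂₀ F ∈ 𝓝 x := by
    refine (hF.isOpen_sInter fun D hD => ?_).mem_nhds hxV
    obtain ⟨a, b, rfl⟩ := hFS hD
    exact isOpen_chronDiamond a b
  obtain ⟨hx₁, hx₂⟩ := h.noChronIsolatedPoints x
  -- Vertices chosen inside the finite intersection lie in each of its diamonds, so the diamond they
  -- span does too.
  obtain ⟨z, ⟨hz, -⟩, hxz⟩ := hX.1 x (mem_univ x) hx₁ _ hV
  obtain ⟨y, ⟨hy, -⟩, hyx⟩ := hX.2 x (mem_univ x) hx₂ _ hV
  refine ⟨y, z, ⟨hyx, hxz⟩, Subset.trans ?_ hVU⟩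
  refine subset_sInter fun D hD => ?_
  have hyD := hy D hD
  have hzD := hz D hD
  obtain ⟨a, b, rfl⟩ := hFS hD
  exact chronDiamond_mono hyD.1 hzD.2

end Basic

theorem IsCausalCurve.continuousOn {X : Type u} [LorentzStructure X] {γ : ℝ → X} {a b : ℝ}
    (h : IsCausalCurve γ a b) : ContinuousOn γ (Icc a b) := h.2.1.continuousOn

theorem IsCausalCurve.caus {X : Type u} [PreLengthSpace X] {γ : ℝ → X} {a b : ℝ}
    (h : IsCausalCurve γ a b) {s t : ℝ} (hs : s ∈ Icc a b) (ht : t ∈ Icc a b) (hst : s ≤ t) :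
    Caus (γ s) (γ t) := by
  rcases hst.eq_or_lt with rfl | hst
  · exact caus_refl _
  · exact h.2.2 s hs t ht hst

/-! ### Causal gluings -/

/-- A space covered by two closed subspaces whose causal structures are induced, such that
relations between points of different subspaces are mediated by common points. -/
structure CausalGluing {X₁ : Type u} {X₂ : Type v} {X : Type w} [PreLengthSpace X₁]
    [PreLengthSpace X₂] [LorentzStructure X] (i : X₁ → X) (j : X₂ → X) : Prop where
  isClosedEmbedding₁ : IsClosedEmbedding i
  isClosedEmbedding₂ : IsClosedEmbedding j
  edist_le₁ : ∀ x y, edist (i x) (i y) ≤ edist x y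
  edist_le₂ : ∀ x y, edist (j x) (j y) ≤ edist x y
  cover : ∀ p, p ∈ range i ∨ p ∈ range j
  caus_trans : ∀ p q r : X, Caus p q → Caus q r → Caus p r
  caus₁ : ∀ x y, Caus (i x) (i y) ↔ Caus x y
  caus₂ : ∀ x y, Caus (j x) (j y) ↔ Caus x y
  caus₁₂ : ∀ x y, Caus (i x) (j y) ↔ ∃ a b, i a = j b ∧ Caus x a ∧ Caus b y
  caus₂₁ : ∀ x y, Caus (j x) (i y) ↔ ∃ a b, j a = i b ∧ Caus x a ∧ Caus b y
  chron₁ : ∀ x y, Chron (i x) (i y) ↔ Chron x y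
  chron₂ : ∀ x y, Chron (j x) (j y) ↔ Chron x y
  chron₁₂ : ∀ x y, Chron (i x) (j y) ↔ ∃ a b, i a = j b ∧ Chron x a ∧ Chron b y
  chron₂₁ : ∀ x y, Chron (j x) (i y) ↔ ∃ a b, j a = i b ∧ Chron x a ∧ Chron b y
  isolating₁ : NonTimelikeLocallyIsolating (i ⁻¹' range j)
  isolating₂ : NonTimelikeLocallyIsolating (j ⁻¹' range i)

namespace CausalGluing

variable {X₁ : Type u} {X₂ : Type v} {X : Type w} [PreLengthSpace X₁] [PreLengthSpace X₂]
  [LorentzStructure X] {i : X₁ → X} {j : X₂ → X}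

protected theorem symm (h : CausalGluing i j) : CausalGluing j i where
  isClosedEmbedding₁ := h.isClosedEmbedding₂
  isClosedEmbedding₂ := h.isClosedEmbedding₁
  edist_le₁ := h.edist_le₂
  edist_le₂ := h.edist_le₁
  cover p := (h.cover p).symm
  caus_trans := h.caus_trans
  caus₁ := h.caus₂
  caus₂ := h.caus₁
  caus₁₂ := h.caus₂₁
  caus₂₁ := h.caus₁₂
  chron₁ := h.chron₂
  chron₂ := h.chron₁
  chron₁₂ := h.chron₂₁
  chron₂₁ := h.chron₁₂
  isolating₁ := h.isolating₂
  isolating₂ := h.isolating₁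

/-! ### Chronology and causality -/

theorem chronological (h : CausalGluing i j) (h₁ : Chronological X₁) (h₂ : Chronological X₂) :
    Chronological X := by
  intro p
  rcases h.cover p with ⟨x, rfl⟩ | ⟨x, rfl⟩
  · rw [h.chron₁]
    exact h₁ x
  · rw [h.chron₂]
    exact h₂ x

/-- The loop passes through a common point `i a = j b`, which splits it into a loop in each
component; causality collapses both. -/
theorem eq_of_caus_of_caus (h : CausalGluing i j) (h₁ : Causal X₁) (h₂ : Causal X₂) {x : X₁}
    {y : X₂} (hxy : Caus (i x) (j y)) (hyx : Caus (j y) (i x)) : i x = j y := by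
  obtain ⟨a, b, hab, hxa, hby⟩ := (h.caus₁₂ x y).1 hxy
  have hya : Caus (j y) (i a) := h.caus_trans _ _ _ hyx ((h.caus₁ _ _).2 hxa)
  rw [hab, h.caus₂] at hya
  obtain rfl := h₂ _ _ hby hya
  rw [← hab, h.caus₁] at hyx
  rw [h₁ _ _ hxa hyx, hab]

theorem causal (h : CausalGluing i j) (h₁ : Causal X₁) (h₂ : Causal X₂) : Causal X := by
  intro p q hpq hqp
  rcases h.cover p with ⟨x, rfl⟩ | ⟨x, rfl⟩ <;> rcases h.cover q with ⟨y, rfl⟩ | ⟨y, rfl⟩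
  · rw [h.caus₁] at hpq hqp
    rw [h₁ _ _ hpq hqp]
  · exact h.eq_of_caus_of_caus h₁ h₂ hpq hqp
  · exact (h.eq_of_caus_of_caus h₁ h₂ hqp hpq).symm
  · rw [h.caus₂] at hpq hqp
    rw [h₂ _ _ hpq hqp]

/-! ### Topology and strong causality -/

theorem isOpen_iff (h : CausalGluing i j) {U : Set X} :
    IsOpen U ↔ IsOpen (i ⁻¹' U) ∧ IsOpen (j ⁻¹' U) := by
  refine ⟨fun hU => ⟨hU.preimage h.isClosedEmbedding₁.continuous,
    hU.preimage h.isClosedEmbedding₂.continuous⟩, fun ⟨hi, hj⟩ => ?_⟩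
  -- The complement is a union of images of two closed sets under closed maps.
  have key : Uᶜ = i '' (i ⁻¹' U)ᶜ ∪ j '' (j ⁻¹' U)ᶜ := by
    ext p
    constructor
    · intro hp
      rcases h.cover p with ⟨x, rfl⟩ | ⟨x, rfl⟩
      · exact Or.inl ⟨x, hp, rfl⟩
      · exact Or.inr ⟨x, hp, rfl⟩
    · rintro (⟨x, hx, rfl⟩ | ⟨x, hx, rfl⟩) <;> exact hx
  rw [← isClosed_compl_iff, key]
  exact (h.isClosedEmbedding₁.isClosedMap _ hi.isClosed_compl).union
    (h.isClosedEmbedding₂.isClosedMap _ hj.isClosed_compl)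

/-- Lower semicontinuity of `tau` on `X` is not among the gluing axioms, so openness is tested on
the components: the trace on the second one is the union of the open futures of the mediating
points. -/
theorem isOpen_chronFuture_map₁ (h : CausalGluing i j) (x : X₁) : IsOpen (chronFuture (i x)) := by
  refine h.isOpen_iff.2 ⟨?_, ?_⟩
  · convert isOpen_chronFuture x using 1
    ext y
    exact h.chron₁ x y
  · have : j ⁻¹' chronFuture (i x) =
        ⋃ b ∈ {b : X₂ | ∃ a, i a = j b ∧ Chron x a}, chronFuture b := by
      ext y
      simp only [mem_preimage, mem_iUnion, chronFuture, mem_ofPred_eq, h.chron₁₂]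
      constructor
      · rintro ⟨a, b, hab, hxa, hby⟩
        exact ⟨b, ⟨a, hab, hxa⟩, hby⟩
      · rintro ⟨b, ⟨a, hab, hxa⟩, hby⟩
        exact ⟨a, b, hab, hxa, hby⟩
    rw [this]
    exact isOpen_biUnion fun b _ => isOpen_chronFuture b

theorem isOpen_chronPast_map₁ (h : CausalGluing i j) (x : X₁) : IsOpen (chronPast (i x)) := by
  refine h.isOpen_iff.2 ⟨?_, ?_⟩
  · convert isOpen_chronPast x using 1
    ext y
    exact h.chron₁ y x
  · have : j ⁻¹' chronPast (i x) =
        ⋃ b ∈ {b : X₂ | ∃ a, j b = i a ∧ Chron a x}, chronPast b := by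
      ext y
      simp only [mem_preimage, mem_iUnion, chronPast, mem_ofPred_eq, h.chron₂₁]
      constructor
      · rintro ⟨b, a, hab, hxa, hby⟩
        exact ⟨b, ⟨a, hab, hby⟩, hxa⟩
      · rintro ⟨b, ⟨a, hab, hxa⟩, hby⟩
        exact ⟨b, a, hab, hby, hxa⟩
    rw [this]
    exact isOpen_biUnion fun b _ => isOpen_chronPast b

theorem isOpen_chronDiamond (h : CausalGluing i j) (p q : X) : IsOpen (chronDiamond p q) := by
  refine IsOpen.inter ?_ ?_
  · rcases h.cover p with ⟨x, rfl⟩ | ⟨x, rfl⟩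
    · exact h.isOpen_chronFuture_map₁ x
    · exact h.symm.isOpen_chronFuture_map₁ x
  · rcases h.cover q with ⟨x, rfl⟩ | ⟨x, rfl⟩
    · exact h.isOpen_chronPast_map₁ x
    · exact h.symm.isOpen_chronPast_map₁ x

/-- A diamond of `X` may contain points of both components. Over a common point this is controlled
by taking its vertices in the common part, where both components can read them; elsewhere the
diamond is taken so small that it misses the common part. -/
theorem exists_chronDiamond_subset (h : CausalGluing i j) (s₁ : StronglyCausal X₁)
    (s₂ : StronglyCausal X₂) (n₁ : NonTimelikeLocallyIsolating (univ : Set X₁))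
    (n₂ : NonTimelikeLocallyIsolating (univ : Set X₂)) {x : X₁} {U : Set X} (hU : IsOpen U)
    (hx : i x ∈ U) : ∃ p q, i x ∈ chronDiamond p q ∧ chronDiamond p q ⊆ U := by
  have hU₁ : i ⁻¹' U ∈ 𝓝 x := (hU.preimage h.isClosedEmbedding₁.continuous).mem_nhds hx
  by_cases hA : i x ∈ range j
  · obtain ⟨x', hx'⟩ := hA
    have hU₂ : j ⁻¹' U ∈ 𝓝 x' := by
      refine (hU.preimage h.isClosedEmbedding₂.continuous).mem_nhds ?_
      rwa [mem_preimage, hx']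
    obtain ⟨y, z, hxyz, hyz⟩ := s₁.exists_chronDiamond_subset n₁ hU₁
    obtain ⟨y', z', hxyz', hyz'⟩ := s₂.exists_chronDiamond_subset n₂ hU₂
    let V : Set X := chronDiamond (i y) (i z) ∩ chronDiamond (j y') (j z')
    have hV : IsOpen V := (h.isOpen_chronDiamond _ _).inter (h.isOpen_chronDiamond _ _)
    have hxV : i x ∈ V := by
      refine ⟨⟨(h.chron₁ _ _).2 hxyz.1, (h.chron₁ _ _).2 hxyz.2⟩, ?_⟩
      rw [← hx']
      exact ⟨(h.chron₂ _ _).2 hxyz'.1, (h.chron₂ _ _).2 hxyz'.2⟩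
    have hV₁ : i ⁻¹' V ∈ 𝓝 x := (hV.preimage h.isClosedEmbedding₁.continuous).mem_nhds hxV
    obtain ⟨hf, hp⟩ := s₁.noChronIsolatedPoints x
    -- Local non-isolation of the common part supplies vertices on both sides of `x` that lie in
    -- both components and inside both diamonds.
    obtain ⟨c, ⟨hcV, c', hc'⟩, hxc⟩ := h.isolating₁.1 x ⟨x', hx'⟩ hf _ hV₁
    obtain ⟨b, ⟨hbV, b', hb'⟩, hbx⟩ := h.isolating₁.2 x ⟨x', hx'⟩ hp _ hV₁
    refine ⟨i b, i c, ⟨(h.chron₁ _ _).2 hbx, (h.chron₁ _ _).2 hxc⟩, fun q hq => ?_⟩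
    rcases h.cover q with ⟨w, rfl⟩ | ⟨w, rfl⟩
    · refine hyz (chronDiamond_mono ((h.chron₁ _ _).1 hbV.1.1) ((h.chron₁ _ _).1 hcV.1.2) ?_)
      exact ⟨(h.chron₁ _ _).1 hq.1, (h.chron₁ _ _).1 hq.2⟩
    · have hbV' := hbV.2.1
      have hcV' := hcV.2.2
      change Chron (j y') (i b) at hbV'
      change Chron (i c) (j z') at hcV'
      rw [← hb'] at hq hbV'
      rw [← hc'] at hq hcV'
      refine hyz' (chronDiamond_mono ((h.chron₂ _ _).1 hbV') ((h.chron₂ _ _).1 hcV') ?_)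
      exact ⟨(h.chron₂ _ _).1 hq.1, (h.chron₂ _ _).1 hq.2⟩
  · have hU' : i ⁻¹' (U ∩ (range j)ᶜ) ∈ 𝓝 x :=
      ((hU.inter h.isClosedEmbedding₂.isClosed_range.isOpen_compl).preimage
        h.isClosedEmbedding₁.continuous).mem_nhds ⟨hx, hA⟩
    obtain ⟨y, z, hxyz, hyz⟩ := s₁.exists_chronDiamond_subset n₁ hU'
    refine ⟨i y, i z, ⟨(h.chron₁ _ _).2 hxyz.1, (h.chron₁ _ _).2 hxyz.2⟩, fun q hq => ?_⟩
    rcases h.cover q with ⟨w, rfl⟩ | ⟨w, rfl⟩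
    · exact (hyz ⟨(h.chron₁ _ _).1 hq.1, (h.chron₁ _ _).1 hq.2⟩).1
    -- A point `w` of the other component would be entered through `a` and left through `b`, both
    -- common, which puts `a` in a diamond that avoids the common part.
    · obtain ⟨a, a', haa', hya, haw⟩ := (h.chron₁₂ _ _).1 hq.1
      obtain ⟨b', b, hbb', hwb, hbz⟩ := (h.chron₂₁ _ _).1 hq.2
      have hab : Chron (i a) (i b) := by
        rw [haa', ← hbb', h.chron₂]
        exact chron_trans _ _ _ haw hwb
      have haz : Chron a z := chron_trans _ _ _ ((h.chron₁ _ _).1 hab) hbz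
      exact absurd ⟨a', haa'.symm⟩ (hyz ⟨hya, haz⟩).2

theorem stronglyCausal (h : CausalGluing i j) (s₁ : StronglyCausal X₁)
    (s₂ : StronglyCausal X₂) (n₁ : NonTimelikeLocallyIsolating (univ : Set X₁))
    (n₂ : NonTimelikeLocallyIsolating (univ : Set X₂)) : StronglyCausal X := by
  have key : ∀ (p : X) (U : Set X), p ∈ U → IsOpen U →
      ∃ D ∈ {D : Set X | ∃ x y : X, D = chronDiamond x y}, p ∈ D ∧ D ⊆ U := by
    intro p U hp hU
    rcases h.cover p with ⟨x, rfl⟩ | ⟨x, rfl⟩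
    · obtain ⟨q, r, hx, hqr⟩ := h.exists_chronDiamond_subset s₁ s₂ n₁ n₂ hU hp
      exact ⟨_, ⟨q, r, rfl⟩, hx, hqr⟩
    · obtain ⟨q, r, hx, hqr⟩ := h.symm.exists_chronDiamond_subset s₂ s₁ n₂ n₁ hU hp
      exact ⟨_, ⟨q, r, rfl⟩, hx, hqr⟩
  constructor
  · refine eq_univ_of_forall fun p => ?_
    obtain ⟨_, ⟨x, y, rfl⟩, hp, -⟩ := key p univ (mem_univ p) isOpen_univ
    exact mem_iUnion.2 ⟨(x, y), hp⟩
  · refine (TopologicalSpace.isTopologicalBasis_of_isOpen_of_nhds ?_ key).eq_generateFrom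
    rintro _ ⟨x, y, rfl⟩
    exact h.isOpen_chronDiamond x y

/-! ### Distinguishing points -/

theorem mem_range_of_chronFuture_eq (h : CausalGluing i j) (s₁ : StronglyCausal X₁)
    (n₁ : NonTimelikeLocallyIsolating (univ : Set X₁)) {x : X₁} {y : X₂}
    (hxy : chronFuture (i x) = chronFuture (j y)) : i x ∈ range j := by
  by_contra hA
  have hU : i ⁻¹' (range j)ᶜ ∈ 𝓝 x := (h.isClosedEmbedding₂.isClosed_range.isOpen_compl.preimage
    h.isClosedEmbedding₁.continuous).mem_nhds hA
  obtain ⟨u, v, huv, hUV⟩ := s₁.exists_chronDiamond_subset n₁ hU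
  obtain ⟨z, ⟨hz, -⟩, hxz⟩ := n₁.1 x (mem_univ x) (s₁.noChronIsolatedPoints x).1 _
    ((Lorentz.isOpen_chronDiamond u v).mem_nhds huv)
  -- Every `z` just after `x` is also in the future of `j y`, hence is reached through a common
  -- point `a`. Equality of futures places `a` after `x` as well, so `a` lies between `x` and `z`,
  -- in a diamond without common points.
  have hz' : i z ∈ chronFuture (j y) := hxy ▸ (h.chron₁ _ _).2 hxz
  obtain ⟨a', a, haa', hya, haz⟩ := (h.chron₂₁ _ _).1 hz'
  have ha : i a ∈ chronFuture (i x) := by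
    rw [hxy, ← haa']
    exact (h.chron₂ _ _).2 hya
  exact hUV ⟨chron_trans _ _ _ huv.1 ((h.chron₁ _ _).1 ha), chron_trans _ _ _ haz hz.2⟩ ⟨a', haa'⟩

theorem mem_range_of_chronPast_eq (h : CausalGluing i j) (s₁ : StronglyCausal X₁)
    (n₁ : NonTimelikeLocallyIsolating (univ : Set X₁)) {x : X₁} {y : X₂}
    (hxy : chronPast (i x) = chronPast (j y)) : i x ∈ range j := by
  by_contra hA
  have hU : i ⁻¹' (range j)ᶜ ∈ 𝓝 x := (h.isClosedEmbedding₂.isClosed_range.isOpen_compl.preimage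
    h.isClosedEmbedding₁.continuous).mem_nhds hA
  obtain ⟨u, v, huv, hUV⟩ := s₁.exists_chronDiamond_subset n₁ hU
  obtain ⟨z, ⟨hz, -⟩, hzx⟩ := n₁.2 x (mem_univ x) (s₁.noChronIsolatedPoints x).2 _
    ((Lorentz.isOpen_chronDiamond u v).mem_nhds huv)
  have hz' : i z ∈ chronPast (j y) := hxy ▸ (h.chron₁ _ _).2 hzx
  obtain ⟨a, a', haa', hza, hay⟩ := (h.chron₁₂ _ _).1 hz'
  have ha : i a ∈ chronPast (i x) := by
    rw [hxy, haa']
    exact (h.chron₂ _ _).2 hay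
  exact hUV ⟨chron_trans _ _ _ hz.1 hza, chron_trans _ _ _ ((h.chron₁ _ _).1 ha) huv.2⟩
    ⟨a', haa'.symm⟩

theorem eq_of_chronFuture_eq (h : CausalGluing i j)
    (d₁ : ∀ x y : X₁, chronFuture x = chronFuture y → x = y) {x y : X₁}
    (hxy : chronFuture (i x) = chronFuture (i y)) : i x = i y := by
  refine congrArg i (d₁ _ _ (Set.ext fun z => ?_))
  have := Set.ext_iff.1 hxy (i z)
  rwa [chronFuture, chronFuture, mem_ofPred_eq, mem_ofPred_eq, h.chron₁, h.chron₁] at this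

theorem eq_of_chronPast_eq (h : CausalGluing i j)
    (d₁ : ∀ x y : X₁, chronPast x = chronPast y → x = y) {x y : X₁}
    (hxy : chronPast (i x) = chronPast (i y)) : i x = i y := by
  refine congrArg i (d₁ _ _ (Set.ext fun z => ?_))
  have := Set.ext_iff.1 hxy (i z)
  rwa [chronPast, chronPast, mem_ofPred_eq, mem_ofPred_eq, h.chron₁, h.chron₁] at this

theorem distinguishing (h : CausalGluing i j) (s₁ : StronglyCausal X₁)
    (s₂ : StronglyCausal X₂) (n₁ : NonTimelikeLocallyIsolating (univ : Set X₁))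
    (n₂ : NonTimelikeLocallyIsolating (univ : Set X₂)) (d₁ : Distinguishing X₁)
    (d₂ : Distinguishing X₂) : Distinguishing X := by
  constructor
  · intro p q hpq
    rcases h.cover p with ⟨x, rfl⟩ | ⟨x, rfl⟩ <;> rcases h.cover q with ⟨y, rfl⟩ | ⟨y, rfl⟩
    · exact h.eq_of_chronFuture_eq d₁.1 hpq
    · obtain ⟨x', hx'⟩ := h.mem_range_of_chronFuture_eq s₁ n₁ hpq
      rw [← hx'] at hpq ⊢
      exact h.symm.eq_of_chronFuture_eq d₂.1 hpq
    · obtain ⟨x', hx'⟩ := h.symm.mem_range_of_chronFuture_eq s₂ n₂ hpq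
      rw [← hx'] at hpq ⊢
      exact h.eq_of_chronFuture_eq d₁.1 hpq
    · exact h.symm.eq_of_chronFuture_eq d₂.1 hpq
  · intro p q hpq
    rcases h.cover p with ⟨x, rfl⟩ | ⟨x, rfl⟩ <;> rcases h.cover q with ⟨y, rfl⟩ | ⟨y, rfl⟩
    · exact h.eq_of_chronPast_eq d₁.2 hpq
    · obtain ⟨x', hx'⟩ := h.mem_range_of_chronPast_eq s₁ n₁ hpq
      rw [← hx'] at hpq ⊢
      exact h.symm.eq_of_chronPast_eq d₂.2 hpq
    · obtain ⟨x', hx'⟩ := h.symm.mem_range_of_chronPast_eq s₂ n₂ hpq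
      rw [← hx'] at hpq ⊢
      exact h.eq_of_chronPast_eq d₁.2 hpq
    · exact h.symm.eq_of_chronPast_eq d₂.2 hpq

end CausalGluing

/-! ### Length bounds for causal curves in a gluing -/

/-- Telescoping: each increment is paid for by the growth of `φ`. The additive form avoids
subtraction in `ℝ≥0∞`. -/
theorem eVariationOn_le_of_potential {α : Type*} [LinearOrder α] {E : Type*}
    [PseudoEMetricSpace E] {f : α → E} {s : Set α} (φ : α → ℝ≥0∞)
    (hφ : ∀ x ∈ s, ∀ y ∈ s, x ≤ y → edist (f x) (f y) + φ x ≤ φ y) {C : ℝ≥0∞}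
    (hC : ∀ x ∈ s, φ x ≤ C) : eVariationOn f s ≤ C := by
  refine iSup_le ?_
  rintro ⟨n, u, hu, us⟩
  have key : ∀ m, (∑ k ∈ Finset.range m, edist (f (u (k + 1))) (f (u k))) + φ (u 0) ≤ φ (u m) := by
    intro m
    induction m with
    | zero => simp
    | succ m ih =>
      rw [Finset.sum_range_succ, add_right_comm, add_comm]
      refine (add_le_add_right ih _).trans ?_
      rw [edist_comm]
      exact hφ _ (us m) _ (us (m + 1)) (hu m.le_succ)
  exact le_self_add.trans ((key n).trans (hC _ (us n)))

/-- `CausalChain K x r`: there is a finite causal chain in `K` of length `r` that ends at `x`. -/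
inductive CausalChain {X : Type u} [LorentzStructure X] (K : Set X) : X → ℝ≥0∞ → Prop
  | single (x : X) (h : x ∈ K) : CausalChain K x 0
  | snoc (x y : X) (r : ℝ≥0∞) (t : CausalChain K x r) (hy : y ∈ K) (h : Caus x y) :
      CausalChain K y (r + edist x y)

theorem CausalChain.exists_seq {X : Type u} [LorentzStructure X] {K : Set X} {x : X} {r : ℝ≥0∞}
    (h : CausalChain K x r) : ∃ (n : ℕ) (c : ℕ → X), c n = x ∧ (∀ k ≤ n, c k ∈ K) ∧
      (∀ k < n, Caus (c k) (c (k + 1))) ∧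
      ∑ k ∈ Finset.range n, edist (c k) (c (k + 1)) = r := by
  induction h with
  | single x hx => exact ⟨0, fun _ => x, rfl, fun _ _ => hx, by simp, by simp⟩
  | snoc x y r t hy h ih =>
    obtain ⟨n, c, rfl, hK, hc, rfl⟩ := ih
    have hup : ∀ k ≤ n, Function.update c (n + 1) y k = c k := fun k hk =>
      Function.update_of_ne (by omega) _ _
    refine ⟨n + 1, Function.update c (n + 1) y, by simp, fun k hk => ?_, fun k hk => ?_, ?_⟩
    · rcases Nat.lt_or_ge n k with hnk | hnk
      · obtain rfl : k = n + 1 := by omega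
        simpa using hy
      · rw [hup k hnk]
        exact hK k hnk
    · rw [hup k (by omega)]
      rcases Nat.lt_or_ge k n with hkn | hkn
      · rw [hup (k + 1) hkn]
        exact hc k hkn
      · obtain rfl : k = n := by omega
        simpa using h
    · rw [Finset.sum_range_succ, hup n le_rfl, Function.update_self]
      congr 1
      refine Finset.sum_congr rfl fun k hk => ?_
      have := Finset.mem_range.1 hk
      rw [hup k (by omega), hup (k + 1) (by omega)]

/-- The supremum of the lengths of the causal chains in `K` whose image under `i` ends in the
causal past of `p`. -/
noncomputable def pastLength {X₁ : Type u} {X : Type w} [LorentzStructure X₁] [LorentzStructure X]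
    (i : X₁ → X) (K : Set X₁) (p : X) : ℝ≥0∞ :=
  sSup {r | ∃ x, CausalChain K x r ∧ Caus (i x) p}

theorem pastLength_le {X₁ : Type u} {X : Type w} [LorentzStructure X₁] [LorentzStructure X]
    {K : Set X₁} {C : ℝ≥0} (hC : ∀ (n : ℕ) (x : ℕ → X₁), (∀ k ≤ n, x k ∈ K) →
      (∀ k < n, Caus (x k) (x (k + 1))) → ∑ k ∈ Finset.range n, edist (x k) (x (k + 1)) ≤ C)
    (i : X₁ → X) (p : X) : pastLength i K p ≤ C := by
  refine sSup_le ?_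
  rintro r ⟨x, hx, -⟩
  obtain ⟨n, c, -, hK, hc, rfl⟩ := hx.exists_seq
  exact hC n c hK hc

namespace CausalGluing

variable {X₁ : Type u} {X₂ : Type v} {X : Type w} [PreLengthSpace X₁] [PreLengthSpace X₂]
  [LorentzStructure X] {i : X₁ → X} {j : X₂ → X}

theorem caus_refl (h : CausalGluing i j) (p : X) : Caus p p := by
  rcases h.cover p with ⟨x, rfl⟩ | ⟨x, rfl⟩
  · exact (h.caus₁ _ _).2 (PreLengthSpace.caus_refl x)
  · exact (h.caus₂ _ _).2 (PreLengthSpace.caus_refl x)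

theorem pastLength_mono (h : CausalGluing i j) (K : Set X₁) {p q : X} (hpq : Caus p q) :
    pastLength i K p ≤ pastLength i K q :=
  sSup_le_sSup fun _ ⟨x, hx, hxp⟩ => ⟨x, hx, h.caus_trans _ _ _ hxp hpq⟩

/-- A chain counted at `x` can be prolonged to `x` and then to `y`, which gains at least the
distance from `x` to `y`. -/
theorem edist_add_pastLength_le (h : CausalGluing i j) {K : Set X₁} {x y : X₁} (hx : x ∈ K)
    (hy : y ∈ K) (hxy : Caus (i x) (i y)) :
    edist (i x) (i y) + pastLength i K (i x) ≤ pastLength i K (i y) := by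
  have hxy' := (h.caus₁ _ _).1 hxy
  -- Addition commutes with a supremum only over a nonempty set; the one-point chain at `x` is a
  -- member.
  have hne : {r | ∃ z, CausalChain K z r ∧ Caus (i z) (i x)}.Nonempty :=
    ⟨0, x, .single x hx, h.caus_refl _⟩
  rw [pastLength, ENNReal.add_sSup hne]
  refine iSup₂_le fun r ⟨z, hz, hzx⟩ => ?_
  have := (hz.snoc z x r hx ((h.caus₁ _ _).1 hzx)).snoc x y _ hy hxy'
  refine le_trans ?_ (le_sSup ⟨y, this, h.caus_refl _⟩)
  rw [add_comm]
  exact add_le_add le_self_add (h.edist_le₁ x y)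

/-- The times a causal curve spends in one component form a closed set that need not be a union of
nondegenerate intervals, so curve lengths there do not suffice; finite causal sequences do. The sum
of the two past lengths serves as potential: the component in which a step takes place pays for the
distance, and the other term is monotone. -/
theorem nonTotallyImprisoning (h : CausalGluing i j) (e₁ : ExtrinsicallyNonTotallyImprisoning X₁)
    (e₂ : ExtrinsicallyNonTotallyImprisoning X₂) : NonTotallyImprisoning X := by
  intro B hB
  obtain ⟨C₁, hC₁, H₁⟩ := e₁ _ (h.isClosedEmbedding₁.isCompact_preimage hB)
  obtain ⟨C₂, -, H₂⟩ := e₂ _ (h.isClosedEmbedding₂.isCompact_preimage hB)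
  refine ⟨C₁ + C₂, by positivity, fun γ a b hγ hγB => ?_⟩
  let φ : X → ℝ≥0∞ := fun p => pastLength i (i ⁻¹' B) p + pastLength j (j ⁻¹' B) p
  have step₁ : ∀ p ∈ B, ∀ q ∈ B, p ∈ range i → q ∈ range i → Caus p q →
      edist p q + φ p ≤ φ q := by
    rintro _ hp _ hq ⟨x, rfl⟩ ⟨y, rfl⟩ hxy
    rw [← add_assoc]
    exact add_le_add (h.edist_add_pastLength_le hp hq hxy) (h.symm.pastLength_mono _ hxy)
  have step₂ : ∀ p ∈ B, ∀ q ∈ B, p ∈ range j → q ∈ range j → Caus p q →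
      edist p q + φ p ≤ φ q := by
    rintro _ hp _ hq ⟨x, rfl⟩ ⟨y, rfl⟩ hxy
    rw [add_left_comm]
    exact add_le_add (h.pastLength_mono _ hxy) (h.symm.edist_add_pastLength_le hp hq hxy)
  refine eVariationOn_le_of_potential (fun t => φ (γ t)) (fun s hs t ht hst => ?_)
    (fun t _ => (add_le_add (pastLength_le H₁ i _) (pastLength_le H₂ j _)).trans_eq
      (ENNReal.coe_add C₁ C₂).symm)
  have hcaus : ∀ x ∈ Icc a b, ∀ y ∈ Icc a b, x ≤ y → Caus (γ x) (γ y) := fun x hx y hy hxy =>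
    hxy.eq_or_lt.elim (fun e => e ▸ h.caus_refl _) fun l => hγ.2.2 x hx y hy l
  -- A step between different components is split at a common point of the curve.
  have hcross : (∃ u ∈ Icc s t, γ u ∈ range i ∧ γ u ∈ range j) →
      γ s ∈ range i ∧ γ t ∈ range j ∨ γ s ∈ range j ∧ γ t ∈ range i →
      edist (γ s) (γ t) + φ (γ s) ≤ φ (γ t) := by
    rintro ⟨u, hu, hui, huj⟩ hc
    have hu' : u ∈ Icc a b := ⟨hs.1.trans hu.1, hu.2.trans ht.2⟩
    have l₁ := hcaus s hs u hu' hu.1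
    have l₂ := hcaus u hu' t ht hu.2
    have hsu : edist (γ s) (γ u) + φ (γ s) ≤ φ (γ u) := by
      rcases hc with hc | hc
      · exact step₁ _ (hγB s hs) _ (hγB u hu') hc.1 hui l₁
      · exact step₂ _ (hγB s hs) _ (hγB u hu') hc.1 huj l₁
    have hut : edist (γ u) (γ t) + φ (γ u) ≤ φ (γ t) := by
      rcases hc with hc | hc
      · exact step₂ _ (hγB u hu') _ (hγB t ht) huj hc.2 l₂
      · exact step₁ _ (hγB u hu') _ (hγB t ht) hui hc.2 l₂
    calc edist (γ s) (γ t) + φ (γ s)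
        ≤ edist (γ s) (γ u) + edist (γ u) (γ t) + φ (γ s) := by
          gcongr
          exact edist_triangle _ _ _
      _ = edist (γ u) (γ t) + (edist (γ s) (γ u) + φ (γ s)) := by ring
      _ ≤ edist (γ u) (γ t) + φ (γ u) := by gcongr
      _ ≤ φ (γ t) := hut
  -- The image of an interval is connected and is covered by two closed sets, so if it meets both it
  -- meets their intersection.
  have hmeet : (γ s ∈ range i ∨ γ t ∈ range i) → (γ s ∈ range j ∨ γ t ∈ range j) →
      ∃ u ∈ Icc s t, γ u ∈ range i ∧ γ u ∈ range j := by
    intro hi hj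
    have hγ' : ContinuousOn γ (Icc s t) := hγ.continuousOn.mono (Icc_subset_Icc hs.1 ht.2)
    have hpre := isPreconnected_Icc.image γ hγ'
    have hmem : γ s ∈ γ '' Icc s t ∧ γ t ∈ γ '' Icc s t :=
      ⟨mem_image_of_mem _ (left_mem_Icc.2 hst), mem_image_of_mem _ (right_mem_Icc.2 hst)⟩
    have hmeets : ∀ S : Set X, γ s ∈ S ∨ γ t ∈ S → (γ '' Icc s t ∩ S).Nonempty :=
      fun S hS => hS.elim (fun h => ⟨γ s, hmem.1, h⟩) fun h => ⟨γ t, hmem.2, h⟩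
    obtain ⟨_, ⟨u, hu, rfl⟩, h₁, h₂⟩ := isPreconnected_closed_iff.1 hpre (range i) (range j)
      h.isClosedEmbedding₁.isClosed_range h.isClosedEmbedding₂.isClosed_range
      (fun p _ => h.cover p)
      (hmeets _ hi) (hmeets _ hj)
    exact ⟨u, hu, h₁, h₂⟩
  rcases h.cover (γ s) with h₁ | h₁ <;> rcases h.cover (γ t) with h₂ | h₂
  · exact step₁ _ (hγB s hs) _ (hγB t ht) h₁ h₂ (hcaus s hs t ht hst)
  · exact hcross (hmeet (.inl h₁) (.inr h₂)) (.inl ⟨h₁, h₂⟩)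
  · exact hcross (hmeet (.inr h₂) (.inl h₁)) (.inr ⟨h₁, h₂⟩)
  · exact step₂ _ (hγB s hs) _ (hγB t ht) h₁ h₂ (hcaus s hs t ht hst)

end CausalGluing

/-! ### Concatenation of causal curves -/

theorem locallyLipschitzOn_Icc_union {E : Type*} [PseudoEMetricSpace E] {γ : ℝ → E} {a b c : ℝ}
    (hab : a ≤ b) (hbc : b ≤ c) (h₁ : LocallyLipschitzOn (Icc a b) γ)
    (h₂ : LocallyLipschitzOn (Icc b c) γ) : LocallyLipschitzOn (Icc a c) γ := by
  intro x hx
  rcases lt_trichotomy x b with hxb | rfl | hxb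
  · obtain ⟨K, t, ht, hK⟩ := h₁ ⟨hx.1, hxb.le⟩
    obtain ⟨u, hu, hxu, hut⟩ := mem_nhdsWithin.1 ht
    refine ⟨K, t, mem_nhdsWithin.2 ⟨u ∩ Iio b, hu.inter isOpen_Iio, ⟨hxu, hxb⟩, ?_⟩, hK⟩
    exact fun y hy => hut ⟨hy.1.1, hy.2.1, hy.1.2.le⟩
  · obtain ⟨K₁, t₁, ht₁, hK₁⟩ := h₁ ⟨hab, le_rfl⟩
    obtain ⟨K₂, t₂, ht₂, hK₂⟩ := h₂ ⟨le_rfl, hbc⟩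
    have hx₁ : x ∈ t₁ := mem_of_mem_nhdsWithin (right_mem_Icc.2 hab) ht₁
    have hx₂ : x ∈ t₂ := mem_of_mem_nhdsWithin (left_mem_Icc.2 hbc) ht₂
    refine ⟨max K₁ K₂, t₁ ∩ Icc a x ∪ t₂ ∩ Icc x c, ?_, ?_⟩
    · rw [← Icc_union_Icc_eq_Icc hab hbc, nhdsWithin_union]
      exact union_mem_sup (inter_mem ht₁ self_mem_nhdsWithin) (inter_mem ht₂ self_mem_nhdsWithin)
    · have hcross : ∀ y ∈ t₁ ∩ Icc a x, ∀ z ∈ t₂ ∩ Icc x c,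
          edist (γ y) (γ z) ≤ (max K₁ K₂ : ℝ≥0) * edist y z := by
        intro y hy z hz
        -- Distances across the junction add up on the line, so the larger of the two constants
        -- works without a factor 2.
        have hd : edist y z = edist y x + edist x z := by
          have h₁ := hy.2.2
          have h₂ := hz.2.1
          simp only [edist_dist, Real.dist_eq]
          rw [← ENNReal.ofReal_add (abs_nonneg _) (abs_nonneg _),
            abs_of_nonpos (by linarith : y - z ≤ 0), abs_of_nonpos (by linarith : y - x ≤ 0),
            abs_of_nonpos (by linarith : x - z ≤ 0)]
          congr 1
          ring
        rw [hd, mul_add]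
        refine (edist_triangle _ (γ x) _).trans (add_le_add ?_ ?_)
        · refine (hK₁ hy.1 hx₁).trans ?_
          gcongr
          exact le_max_left _ _
        · refine (hK₂ hx₂ hz.1).trans ?_
          gcongr
          exact le_max_right _ _
      rintro y (hy | hy) z (hz | hz)
      · refine (hK₁ hy.1 hz.1).trans ?_
        gcongr
        exact le_max_left _ _
      · exact hcross y hy z hz
      · rw [edist_comm (γ y), edist_comm y]
        exact hcross z hz y hy
      · refine (hK₂ hy.1 hz.1).trans ?_
        gcongr
        exact le_max_right _ _
  · obtain ⟨K, t, ht, hK⟩ := h₂ ⟨hxb.le, hx.2⟩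
    obtain ⟨u, hu, hxu, hut⟩ := mem_nhdsWithin.1 ht
    refine ⟨K, t, mem_nhdsWithin.2 ⟨u ∩ Ioi b, hu.inter isOpen_Ioi, ⟨hxu, hxb⟩, ?_⟩, hK⟩
    exact fun y hy => hut ⟨hy.1.1, hy.1.2.le, hy.2.2⟩

theorem locallyLipschitzOn_congr {E : Type*} [PseudoEMetricSpace E] {γ σ : ℝ → E} {s : Set ℝ}
    (h : LocallyLipschitzOn s γ) (hσ : EqOn σ γ s) : LocallyLipschitzOn s σ := by
  intro x hx
  obtain ⟨K, t, ht, hK⟩ := h hx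
  refine ⟨K, t ∩ s, inter_mem ht self_mem_nhdsWithin, fun y hy z hz => ?_⟩
  rw [hσ hy.2, hσ hz.2]
  exact hK hy.1 hz.1

theorem locallyLipschitzOn_comp_add_right {E : Type*} [PseudoEMetricSpace E] {γ : ℝ → E}
    {a b d : ℝ} (h : LocallyLipschitzOn (Icc (a + d) (b + d)) γ) :
    LocallyLipschitzOn (Icc a b) (fun t => γ (t + d)) := by
  intro x hx
  have hmaps : MapsTo (· + d) (Icc a b) (Icc (a + d) (b + d)) := fun y hy =>
    ⟨by simpa using hy.1, by simpa using hy.2⟩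
  obtain ⟨K, t, ht, hK⟩ := h (hmaps hx)
  refine ⟨K, (· + d) ⁻¹' t, ?_, fun y hy z hz => ?_⟩
  · exact ((continuous_add_const d).continuousWithinAt.tendsto_nhdsWithin hmaps) ht
  · simpa using hK hy hz

section Concatenation

variable {X : Type u} [PreLengthSpace X]

/-- The second curve is shifted in time to start at `b`. For it only the distance of the endpoints
is retained in the length bound, which is what summing over a causal sequence needs. -/
theorem IsCausalCurve.exists_concat {γ γ' : ℝ → X} {a b a' b' : ℝ} (h : IsCausalCurve γ a b)
    (h' : IsCausalCurve γ' a' b') (hb : γ b = γ' a') :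
    ∃ (σ : ℝ → X) (c : ℝ), IsCausalCurve σ a c ∧ σ a = γ a ∧ σ c = γ' b' ∧
      curveLength γ a b + edist (γ' a') (γ' b') ≤ curveLength σ a c := by
  have hab := h.1
  have hab' := h'.1
  let d := a' - b
  let c := b + (b' - a')
  have hbd : b + d = a' := by simp [d]
  have hcd : c + d = b' := by simp only [c, d]; ring
  have hbc : b < c := by simp only [c]; linarith
  let σ : ℝ → X := fun t => if t ≤ b then γ t else γ' (t + d)
  have hσ₁ : EqOn σ γ (Icc a b) := fun t ht => if_pos ht.2
  have hσ₂ : EqOn σ (fun t => γ' (t + d)) (Icc b c) := by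
    intro t ht
    rcases ht.1.eq_or_lt with rfl | hlt
    · simp only [σ, if_pos le_rfl, hbd, hb]
    · exact if_neg hlt.not_ge
  have hσb : σ b = γ b := hσ₁ ⟨hab.le, le_rfl⟩
  have hσc : σ c = γ' b' := (hσ₂ ⟨hbc.le, le_rfl⟩).trans (congrArg γ' hcd)
  have c₁ : ∀ s ∈ Icc a b, ∀ t ∈ Icc a b, s ≤ t → Caus (σ s) (σ t) := by
    intro s hs t ht hst
    rw [hσ₁ hs, hσ₁ ht]
    exact h.caus hs ht hst
  have c₂ : ∀ s ∈ Icc b c, ∀ t ∈ Icc b c, s ≤ t → Caus (σ s) (σ t) := by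
    intro s hs t ht hst
    rw [hσ₂ hs, hσ₂ ht]
    refine h'.caus ⟨?_, ?_⟩ ⟨?_, ?_⟩ (by linarith) <;> linarith [hs.1, hs.2, ht.1, ht.2]
  refine ⟨σ, c, ⟨hab.trans hbc, ?_, fun s hs t ht hst => ?_⟩, hσ₁ ⟨le_rfl, hab.le⟩, hσc, ?_⟩
  · refine locallyLipschitzOn_Icc_union hab.le hbc.le (locallyLipschitzOn_congr h.2.1 hσ₁)
      (locallyLipschitzOn_congr (locallyLipschitzOn_comp_add_right ?_) hσ₂)
    rw [hbd, hcd]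
    exact h'.2.1
  · rcases le_total t b with htb | htb
    · exact c₁ s ⟨hs.1, hst.le.trans htb⟩ t ⟨ht.1, htb⟩ hst.le
    · rcases le_total s b with hsb | hsb
      · exact caus_trans _ _ _ (c₁ s ⟨hs.1, hsb⟩ b ⟨hab.le, le_rfl⟩ hsb)
          (c₂ b ⟨le_rfl, hbc.le⟩ t ⟨htb, ht.2⟩ htb)
      · exact c₂ s ⟨hsb, hs.2⟩ t ⟨htb, ht.2⟩ hst.le
  · have hadd := eVariationOn.add_le_union σ (s := Icc a b) (t := Icc b c)
      fun x hx y hy => hx.2.trans hy.1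
    rw [Icc_union_Icc_eq_Icc hab.le hbc.le, eVariationOn.eq_of_eqOn hσ₁] at hadd
    refine (add_le_add_right ?_ _).trans hadd
    rw [← hb, ← hσb, ← hσc]
    exact eVariationOn.edist_le σ ⟨le_rfl, hbc.le⟩ ⟨hbc.le, le_rfl⟩

theorem CausallyPathConnected.exists_curve_through (hX : CausallyPathConnected X) (x : ℕ → X)
    (n : ℕ) (hx : ∀ k < n, Caus (x k) (x (k + 1))) :
    ∃ (γ : ℝ → X) (a b : ℝ), IsCausalCurve γ a b ∧ γ a = x 0 ∧ γ b = x n ∧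
      ∑ k ∈ Finset.range n, edist (x k) (x (k + 1)) ≤ curveLength γ a b := by
  induction n with
  | zero =>
    -- Curves have nondegenerate domains, so even the empty sum needs a curve, here from `x 0` to
    -- itself.
    obtain ⟨γ, a, b, h, ha, hb⟩ := hX.2 (x 0) (x 0) (caus_refl _)
    exact ⟨γ, a, b, h, ha, hb, by simp⟩
  | succ n ih =>
    obtain ⟨γ, a, b, h, ha, hb, hl⟩ := ih fun k hk => hx k (by omega)
    obtain ⟨γ', a', b', h', ha', hb'⟩ := hX.2 _ _ (hx n n.lt_succ_self)
    obtain ⟨σ, c, hσ, hσa, hσc, hσl⟩ := h.exists_concat h' (hb.trans ha'.symm)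
    refine ⟨σ, a, c, hσ, hσa.trans ha, hσc.trans hb', ?_⟩
    rw [Finset.sum_range_succ]
    rw [ha', hb'] at hσl
    exact (add_le_add_left hl _).trans hσl

/-- Finitely many timelike diamonds cover `K`. A curve through the sequence stays between the lower
vertex of a diamond around its first point and the upper vertex of one around its last point, hence
in one of finitely many compact causal diamonds. -/
theorem GloballyHyperbolic.extrinsicallyNonTotallyImprisoning (h : GloballyHyperbolic X)
    (hX : CausallyPathConnected X) (hI : NoChronIsolatedPoints X) :
    ExtrinsicallyNonTotallyImprisoning X := by
  intro K hK
  choose q hq using fun x => (hI x).1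
  choose p hp using fun x => (hI x).2
  obtain ⟨t, ht⟩ := hK.elim_finite_subcover (fun x => chronDiamond (p x) (q x))
    (fun x => isOpen_chronDiamond _ _) fun x _ => mem_iUnion.2 ⟨x, hp x, hq x⟩
  choose C hC H using fun y z : X => h.1 _ (h.2 (p y) (q z))
  -- The sum dominates the constant of every pair; the added 1 keeps the bound positive when `t` is
  -- empty.
  refine ⟨(∑ y ∈ t, ∑ z ∈ t, C y z) + 1, by positivity, fun n x hxK hx => ?_⟩
  obtain ⟨y, hy, hy'⟩ := mem_iUnion₂.1 (ht (hxK 0 (Nat.zero_le n)))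
  obtain ⟨z, hz, hz'⟩ := mem_iUnion₂.1 (ht (hxK n le_rfl))
  obtain ⟨γ, a, b, hγ, ha, hb, hl⟩ := hX.exists_curve_through x n hx
  refine hl.trans ((H y z γ a b hγ fun s hs => ⟨?_, ?_⟩).trans ?_)
  · refine caus_trans _ _ _ (chron_caus _ _ hy'.1) ?_
    rw [← ha]
    exact hγ.caus ⟨le_rfl, hγ.1.le⟩ hs hs.1
  · refine caus_trans _ _ _ ?_ (chron_caus _ _ hz'.2)
    rw [← hb]
    exact hγ.caus hs ⟨hγ.1.le, le_rfl⟩ hs.2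
  · refine ENNReal.coe_le_coe.2 (le_trans ?_ le_self_add)
    exact (Finset.single_le_sum (f := fun z => C y z) (fun _ _ => zero_le) hz).trans
      (Finset.single_le_sum (f := fun y => ∑ z ∈ t, C y z) (fun _ _ => zero_le) hy)

/-! ### Closedness of the causal relation -/

/-- A causal curve of length at most `N * δ` can be subdivided into `N + 1` steps of size `δ`. -/
theorem exists_seq_edist_le_of_eVariationOn_le {γ : ℝ → X} {b : ℝ} {δ : ℝ≥0∞} (hδ : δ ≠ ⊤)
    (N : ℕ) : ∀ a ≤ b, ContinuousOn γ (Icc a b) →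
    (∀ s ∈ Icc a b, ∀ t ∈ Icc a b, s ≤ t → Caus (γ s) (γ t)) →
    eVariationOn γ (Icc a b) ≤ N * δ →
    ∃ x : ℕ → X, x 0 = γ a ∧ x (N + 1) = γ b ∧ (∀ k, x k ∈ γ '' Icc a b) ∧
      ∀ k, Caus (x k) (x (k + 1)) ∧ edist (x k) (x (k + 1)) ≤ δ := by
  induction N with
  | zero =>
    intro a hab hγ hc hv
    have hd := eVariationOn.edist_le γ (left_mem_Icc.2 hab) (right_mem_Icc.2 hab)
    -- The sequence is constant from index 1 on, so the step conditions hold at all indices by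
    -- reflexivity.
    refine ⟨fun k => if k = 0 then γ a else γ b, by simp, by simp, fun k => ?_, fun k => ?_⟩
    · rcases k with _ | k
      · exact mem_image_of_mem _ (left_mem_Icc.2 hab)
      · exact mem_image_of_mem _ (right_mem_Icc.2 hab)
    · rcases k with _ | k
      · exact ⟨hc _ (left_mem_Icc.2 hab) _ (right_mem_Icc.2 hab) hab,
          (hd.trans hv).trans (by simp)⟩
      · simpa using caus_refl _
  | succ N ih =>
    intro a hab hγ hc hv
    have step : ∃ t ∈ Icc a b, edist (γ a) (γ t) ≤ δ ∧ eVariationOn γ (Icc t b) ≤ N * δ := by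
      rcases le_total (edist (γ a) (γ b)) δ with hle | hge
      · refine ⟨b, right_mem_Icc.2 hab, hle, ?_⟩
        rw [eVariationOn.subsingleton _ (by simp)]
        exact zero_le
      · have hg : ContinuousOn (fun t => edist (γ a) (γ t)) (Icc a b) :=
          fun t ht => tendsto_const_nhds.edist (hγ t ht)
        -- Stopping at distance exactly `δ` uses up at least `δ` of the length, which leaves at most
        -- `N * δ` for the rest.
        obtain ⟨t, ht, htδ⟩ := intermediate_value_Icc hab hg
          (show δ ∈ Icc (edist (γ a) (γ a)) (edist (γ a) (γ b)) from ⟨by simp, hge⟩)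
        refine ⟨t, ht, htδ.le, ?_⟩
        have hadd := eVariationOn.Icc_add_Icc γ (s := univ) ht.1 ht.2 (mem_univ t)
        simp only [univ_inter] at hadd
        have hδv : δ ≤ eVariationOn γ (Icc a t) := htδ ▸
          eVariationOn.edist_le γ (left_mem_Icc.2 ht.1) (right_mem_Icc.2 ht.1)
        refine (ENNReal.add_le_add_iff_left hδ).1 ((add_le_add_left hδv _).trans ?_)
        rw [hadd]
        refine hv.trans_eq ?_
        push_cast
        ring
    obtain ⟨t, ht, htδ, hvt⟩ := step
    have hsub : Icc t b ⊆ Icc a b := Icc_subset_Icc_left ht.1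
    obtain ⟨x, hx₀, hxN, hxm, hx⟩ := ih t ht.2 (hγ.mono hsub)
      (fun s hs s' hs' => hc s (hsub hs) s' (hsub hs')) hvt
    refine ⟨fun k => Nat.casesOn k (γ a) x, rfl, hxN, fun k => ?_, fun k => ?_⟩
    · rcases k with _ | k
      · exact mem_image_of_mem _ (left_mem_Icc.2 hab)
      · exact image_mono hsub (hxm k)
    · rcases k with _ | k
      · change Caus (γ a) (x 0) ∧ edist (γ a) (x 0) ≤ δ
        rw [hx₀]
        exact ⟨hc _ (left_mem_Icc.2 hab) _ ht ht.1, htδ⟩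
      · exact hx k

theorem CausallyClosed.mono {U V : Set X} (h : CausallyClosed U) (hVU : V ⊆ U) :
    CausallyClosed V := fun p q p' q' hp hq hpq hp' hq' =>
  h p q p' q' (fun n => hVU (hp n)) (fun n => hVU (hq n)) hpq (closure_mono hVU hp')
    (closure_mono hVU hq')

/-- A Lebesgue number of the cover by interiors of causally closed neighbourhoods puts `p'` and any
`ε`-close `q'` in a common one, together with tails of both sequences. -/
theorem LocallyCausallyClosed.exists_edist_lt (h : LocallyCausallyClosed X) {K : Set X}
    (hK : IsCompact K) : ∃ ε > 0, ∀ (p q : ℕ → X), ∀ p' ∈ K, ∀ q', Tendsto p atTop (𝓝 p') →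
      Tendsto q atTop (𝓝 q') → (∀ n, Caus (p n) (q n)) → edist p' q' < ε → Caus p' q' := by
  choose U hU hc using h
  obtain ⟨ε, hε, H⟩ := lebesgue_number_lemma_of_emetric (c := fun x => interior (U x)) hK
    (fun x => isOpen_interior) fun x _ => mem_iUnion.2 ⟨x, mem_interior_iff_mem_nhds.2 (hU x)⟩
  refine ⟨ε, hε, fun p q p' hp' q' hp hq hpq hd => ?_⟩
  obtain ⟨x, hx⟩ := H p' hp'
  have hp'x : p' ∈ interior (U x) := hx (by simpa using hε)
  have hq'x : q' ∈ interior (U x) := hx (by simpa [edist_comm] using hd)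
  have ep := hp.eventually (isOpen_interior.mem_nhds hp'x)
  have eq := hq.eventually (isOpen_interior.mem_nhds hq'x)
  obtain ⟨n₀, hn₀⟩ := eventually_atTop.1 (ep.and eq)
  exact (hc x).mono interior_subset (fun n => p (n + n₀)) (fun n => q (n + n₀)) p' q'
    (fun n => (hn₀ _ (by omega)).1) (fun n => (hn₀ _ (by omega)).2) (fun n => hpq _)
    (subset_closure hp'x) (subset_closure hq'x) ((tendsto_add_atTop_iff_nat n₀).2 hp)
    ((tendsto_add_atTop_iff_nat n₀).2 hq)

/-- Under global hyperbolicity the causal relation is closed. -/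
theorem GloballyHyperbolic.caus_of_tendsto (h : GloballyHyperbolic X)
    (hX : CausallyPathConnected X) (hI : NoChronIsolatedPoints X) (hL : LocallyCausallyClosed X)
    {p q : ℕ → X} {p' q' : X} (hpq : ∀ n, Caus (p n) (q n)) (hp : Tendsto p atTop (𝓝 p'))
    (hq : Tendsto q atTop (𝓝 q')) : Caus p' q' := by
  -- Eventually the sequences lie after `u` and before `v`, so the connecting curves lie in one
  -- compact diamond and their lengths have a common bound.
  obtain ⟨u, hu⟩ := (hI p').2
  obtain ⟨v, hv⟩ := (hI q').1
  have ep := hp.eventually ((isOpen_chronFuture u).mem_nhds hu)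
  have eq := hq.eventually ((isOpen_chronPast v).mem_nhds hv)
  obtain ⟨n₀, hn₀⟩ := eventually_atTop.1 (ep.and eq)
  have hK := h.2 u v
  obtain ⟨C, -, hC⟩ := h.1 _ hK
  obtain ⟨ε, hε, hcl⟩ := hL.exists_edist_lt hK
  obtain ⟨δ, hδ₀, hδε⟩ := exists_between hε
  -- One number of steps serves all the curves, because the length bound is uniform.
  obtain ⟨N, hN⟩ := ENNReal.exists_nat_mul_gt hδ₀.ne' (ENNReal.coe_ne_top (r := C))
  have hchain : ∀ n, ∃ x : ℕ → X, x 0 = p (n + n₀) ∧ x (N + 1) = q (n + n₀) ∧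
      (∀ k, x k ∈ causDiamond u v) ∧
      ∀ k, Caus (x k) (x (k + 1)) ∧ edist (x k) (x (k + 1)) ≤ δ := by
    intro n
    obtain ⟨γ, a, b, hγ, ha, hb⟩ := hX.2 _ _ (hpq (n + n₀))
    obtain ⟨hn₁, hn₂⟩ := hn₀ (n + n₀) (by omega)
    have hm : ∀ t ∈ Icc a b, γ t ∈ causDiamond u v := by
      refine fun t ht => ⟨caus_trans _ _ _ (chron_caus _ _ hn₁) ?_,
        caus_trans _ _ _ ?_ (chron_caus _ _ hn₂)⟩
      · rw [← ha]
        exact hγ.caus ⟨le_rfl, hγ.1.le⟩ ht ht.1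
      · rw [← hb]
        exact hγ.caus ht ⟨hγ.1.le, le_rfl⟩ ht.2
    obtain ⟨x, hx₀, hxN, hxm, hx⟩ := exists_seq_edist_le_of_eVariationOn_le hδε.ne_top N a hγ.1.le
      hγ.continuousOn (fun s hs t ht => hγ.caus hs ht) ((hC γ a b hγ hm).trans hN.le)
    refine ⟨x, hx₀.trans ha, hxN.trans hb, fun k => ?_, hx⟩
    obtain ⟨t, ht, hxt⟩ := hxm k
    exact hxt ▸ hm t ht
  choose x hx₀ hxN hxm hx using hchain
  -- Compactness of the countable product makes all subdivision points converge along one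
  -- subsequence. Limits of neighbours are within `δ < ε`, so local closedness applies to each step.
  obtain ⟨c, hcm, φ, hφ, hlim⟩ := (isCompact_univ_pi fun _ : ℕ => hK).tendsto_subseq
    (x := x) fun n k _ => hxm n k
  have hlim' : ∀ k, Tendsto (fun n => x (φ n) k) atTop (𝓝 (c k)) := tendsto_pi_nhds.1 hlim
  have hc₀ : c 0 = p' := by
    refine tendsto_nhds_unique (hlim' 0) ?_
    simp only [hx₀]
    exact ((tendsto_add_atTop_iff_nat n₀).2 hp).comp hφ.tendsto_atTop
  have hcN : c (N + 1) = q' := by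
    refine tendsto_nhds_unique (hlim' (N + 1)) ?_
    simp only [hxN]
    exact ((tendsto_add_atTop_iff_nat n₀).2 hq).comp hφ.tendsto_atTop
  have hstep : ∀ k, Caus (c k) (c (k + 1)) := fun k =>
    hcl _ _ _ (hcm k (mem_univ k)) _ (hlim' k) (hlim' (k + 1)) (fun n => (hx _ k).1)
      ((le_of_tendsto ((hlim' k).edist (hlim' (k + 1)))
        (Eventually.of_forall fun n => (hx _ k).2)).trans_lt hδε)
  have hall : ∀ k, Caus (c 0) (c k) := by
    intro k
    induction k with
    | zero => exact caus_refl _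
    | succ k ih => exact caus_trans _ _ _ ih (hstep k)
  rw [← hc₀, ← hcN]
  exact hall _

end Concatenation

/-! ### Global hyperbolicity of a gluing -/

namespace CausalGluing

variable {X₁ : Type u} {X₂ : Type v} {X : Type w} [PreLengthSpace X₁] [PreLengthSpace X₂]
  [LorentzStructure X] {i : X₁ → X} {j : X₂ → X}

/-- The future of a point of the second component enters the first through common points, and by
time observation these lie after a single common point. -/
theorem exists_lower (h : CausalGluing i j) (t : TimeObserving (j ⁻¹' range i)) (p : X) :
    ∃ l, ∀ x, Caus p (i x) → Caus l x := by
  rcases h.cover p with ⟨y, rfl⟩ | ⟨y, rfl⟩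
  · exact ⟨y, fun x => (h.caus₁ y x).1⟩
  · obtain ⟨a, ⟨l, hl⟩, ha⟩ := t.1 y
    refine ⟨l, fun x hx => ?_⟩
    obtain ⟨b, b', hb, hyb, hbx⟩ := (h.caus₂₁ _ _).1 hx
    have hab : Caus a b := (ha ⟨hyb, ⟨b', hb.symm⟩⟩).1
    rw [← h.caus₂, ← hl, hb, h.caus₁] at hab
    exact PreLengthSpace.caus_trans _ _ _ hab hbx

theorem exists_upper (h : CausalGluing i j) (t : TimeObserving (j ⁻¹' range i)) (p : X) :
    ∃ l, ∀ x, Caus (i x) p → Caus x l := by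
  rcases h.cover p with ⟨y, rfl⟩ | ⟨y, rfl⟩
  · exact ⟨y, fun x => (h.caus₁ x y).1⟩
  · obtain ⟨a, ⟨l, hl⟩, ha⟩ := t.2 y
    refine ⟨l, fun x hx => ?_⟩
    obtain ⟨b', b, hb, hxb, hby⟩ := (h.caus₁₂ _ _).1 hx
    have hab : Caus b a := (ha ⟨hby, ⟨b', hb⟩⟩).1
    rw [← h.caus₂, ← hl, ← hb, h.caus₁] at hab
    exact PreLengthSpace.caus_trans _ _ _ hxb hab

theorem exists_isCompact_preimage_subset (h : CausalGluing i j)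
    (t : TimeObserving (j ⁻¹' range i)) (hc : ∀ x y : X₁, IsCompact (causDiamond x y)) (p q : X) :
    ∃ K, IsCompact K ∧ i ⁻¹' causDiamond p q ⊆ K := by
  obtain ⟨l, hl⟩ := h.exists_lower t p
  obtain ⟨m, hm⟩ := h.exists_upper t q
  exact ⟨_, hc l m, fun x hx => ⟨hl x hx.1, hm x hx.2⟩⟩

theorem caus_of_tendsto_map₁ (h : CausalGluing i j) (cl : ∀ (p q : ℕ → X₁) (p' q' : X₁),
      (∀ n, Caus (p n) (q n)) → Tendsto p atTop (𝓝 p') → Tendsto q atTop (𝓝 q') → Caus p' q')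
    {x y : ℕ → X₁} {p q : X} (hxy : ∀ n, Caus (i (x n)) (i (y n)))
    (hx : Tendsto (i ∘ x) atTop (𝓝 p)) (hy : Tendsto (i ∘ y) atTop (𝓝 q)) : Caus p q := by
  obtain ⟨p, rfl⟩ := h.isClosedEmbedding₁.isClosed_range.mem_of_tendsto hx
    (Eventually.of_forall fun n => mem_range_self _)
  obtain ⟨q, rfl⟩ := h.isClosedEmbedding₁.isClosed_range.mem_of_tendsto hy
    (Eventually.of_forall fun n => mem_range_self _)
  rw [← h.isClosedEmbedding₁.tendsto_nhds_iff] at hx hy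
  exact (h.caus₁ _ _).2 (cl x y p q (fun n => (h.caus₁ _ _).1 (hxy n)) hx hy)

/-- The mediating points lie between `r` and `s`, hence in the compact set `K`. A limit of a
subsequence of them mediates between `p` and `q`, since the causal relation is closed in each
component. -/
theorem caus_of_tendsto_map₁₂ (h : CausalGluing i j) (cl₁ : ∀ (p q : ℕ → X₁) (p' q' : X₁),
      (∀ n, Caus (p n) (q n)) → Tendsto p atTop (𝓝 p') → Tendsto q atTop (𝓝 q') → Caus p' q')
    (cl₂ : ∀ (p q : ℕ → X₂) (p' q' : X₂),
      (∀ n, Caus (p n) (q n)) → Tendsto p atTop (𝓝 p') → Tendsto q atTop (𝓝 q') → Caus p' q')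
    {K : Set X₁} (hK : IsCompact K) {r s : X} (hKs : i ⁻¹' causDiamond r s ⊆ K)
    {x : ℕ → X₁} {y : ℕ → X₂} {p q : X} (hxy : ∀ n, Caus (i (x n)) (j (y n)))
    (hr : ∀ n, Caus r (i (x n))) (hs : ∀ n, Caus (j (y n)) s)
    (hx : Tendsto (i ∘ x) atTop (𝓝 p)) (hy : Tendsto (j ∘ y) atTop (𝓝 q)) : Caus p q := by
  choose a b hab hxa hby using fun n => (h.caus₁₂ _ _).1 (hxy n)
  have hxa' := fun n => (h.caus₁ _ _).2 (hxa n)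
  have hby' := fun n => (h.caus₂ _ _).2 (hby n)
  have haK : ∀ n, a n ∈ K := fun n => by
    refine hKs ⟨h.caus_trans _ _ _ (hr n) (hxa' n), ?_⟩
    change Caus (i (a n)) s
    rw [hab]
    exact h.caus_trans _ _ _ (hby' n) (hs n)
  obtain ⟨c, -, φ, hφ, hlim⟩ := hK.tendsto_subseq haK
  have hlim' : Tendsto (i ∘ a ∘ φ) atTop (𝓝 (i c)) :=
    (h.isClosedEmbedding₁.continuous.tendsto c).comp hlim
  have h₁ : Caus p (i c) := h.caus_of_tendsto_map₁ cl₁ (x := x ∘ φ) (y := a ∘ φ)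
    (fun n => hxa' (φ n)) (hx.comp hφ.tendsto_atTop) hlim'
  have heq : i ∘ a ∘ φ = j ∘ b ∘ φ := funext fun n => hab (φ n)
  have h₂ : Caus (i c) q := h.symm.caus_of_tendsto_map₁ cl₂ (x := b ∘ φ) (y := y ∘ φ)
    (fun n => hby' (φ n)) (heq ▸ hlim') (hy.comp hφ.tendsto_atTop)
  exact h.caus_trans _ _ _ h₁ h₂

theorem globallyHyperbolic (h : CausalGluing i j) (I₁ : NoChronIsolatedPoints X₁)
    (I₂ : NoChronIsolatedPoints X₂) (P₁ : CausallyPathConnected X₁) (P₂ : CausallyPathConnected X₂)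
    (L₁ : LocallyCausallyClosed X₁) (L₂ : LocallyCausallyClosed X₂) (G₁ : GloballyHyperbolic X₁)
    (G₂ : GloballyHyperbolic X₂) (T₁ : TimeObserving (i ⁻¹' range j))
    (T₂ : TimeObserving (j ⁻¹' range i)) : GloballyHyperbolic X := by
  refine ⟨h.nonTotallyImprisoning (G₁.extrinsicallyNonTotallyImprisoning P₁ I₁)
    (G₂.extrinsicallyNonTotallyImprisoning P₂ I₂), fun r s => ?_⟩
  obtain ⟨K₁, hK₁, hs₁⟩ := h.exists_isCompact_preimage_subset T₂ G₁.2 r s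
  obtain ⟨K₂, hK₂, hs₂⟩ := h.symm.exists_isCompact_preimage_subset T₁ G₂.2 r s
  have cl₁ := fun (p q : ℕ → X₁) (p' q' : X₁) => G₁.caus_of_tendsto P₁ I₁ L₁ (p := p) (q := q)
    (p' := p') (q' := q')
  have cl₂ := fun (p q : ℕ → X₂) (p' q' : X₂) => G₂.caus_of_tendsto P₂ I₂ L₂ (p := p) (q := q)
    (p' := p') (q' := q')
  -- Some component contains infinitely many terms of the sequence.
  have hlift : ∀ p : ℕ → X, ∃ φ : ℕ → ℕ, StrictMono φ ∧
      ((∃ x : ℕ → X₁, i ∘ x = p ∘ φ) ∨ ∃ x : ℕ → X₂, j ∘ x = p ∘ φ) := by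
    intro p
    rcases frequently_or_distrib.1 (Frequently.of_forall (f := atTop) fun n => h.cover (p n))
      with hf | hf
    · obtain ⟨φ, hφ, hx⟩ := extraction_of_frequently_atTop hf
      choose x hx using hx
      exact ⟨φ, hφ, .inl ⟨x, funext hx⟩⟩
    · obtain ⟨φ, hφ, hx⟩ := extraction_of_frequently_atTop hf
      choose x hx using hx
      exact ⟨φ, hφ, .inr ⟨x, funext hx⟩⟩
  have key : ∀ (p q : ℕ → X) (p' q' : X), (∀ n, Caus (p n) (q n)) → (∀ n, Caus r (p n)) →
      (∀ n, Caus (q n) s) → Tendsto p atTop (𝓝 p') → Tendsto q atTop (𝓝 q') → Caus p' q' := by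
    intro p q p' q' hpq hr hs hp hq
    obtain ⟨φ, hφ, hx⟩ := hlift p
    obtain ⟨ψ, hψ, hy⟩ := hlift (q ∘ φ)
    have hp' := hp.comp (hφ.comp hψ).tendsto_atTop
    have hq' := hq.comp (hφ.comp hψ).tendsto_atTop
    have hpq' := fun n => hpq (φ (ψ n))
    have hr' := fun n => hr (φ (ψ n))
    have hs' := fun n => hs (φ (ψ n))
    rcases hx with ⟨x, hx⟩ | ⟨x, hx⟩ <;> rcases hy with ⟨y, hy⟩ | ⟨y, hy⟩ <;>
      simp only [funext_iff, Function.comp_apply] at hx hy <;>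
      simp only [← hx, ← hy] at hpq' hr' hs' <;>
      simp only [Function.comp_def, ← hx, ← hy] at hp' hq'
    · exact h.caus_of_tendsto_map₁ cl₁ hpq' hp' hq'
    · exact h.caus_of_tendsto_map₁₂ cl₁ cl₂ hK₁ hs₁ hpq' hr' hs' hp' hq'
    · exact h.symm.caus_of_tendsto_map₁₂ cl₂ cl₁ hK₂ hs₂ hpq' hr' hs' hp' hq'
    · exact h.symm.caus_of_tendsto_map₁ cl₂ hpq' hp' hq'
  -- The diamond lies in a union of two compact sets. It is closed by `key`, applied with one of the
  -- sequences constantly `r` or `s`.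
  refine ((hK₁.image h.isClosedEmbedding₁.continuous).union
    (hK₂.image h.isClosedEmbedding₂.continuous)).of_isClosed_subset ?_ fun p hp => ?_
  · refine IsSeqClosed.isClosed fun x p hx hp => ⟨?_, ?_⟩
    · exact key (fun _ => r) x r p (fun n => (hx n).1) (fun _ => h.caus_refl r)
        (fun n => (hx n).2) tendsto_const_nhds hp
    · exact key x (fun _ => s) p s (fun n => (hx n).2) (fun n => (hx n).1)
        (fun _ => h.caus_refl s) hp tendsto_const_nhds
  · rcases h.cover p with ⟨x, rfl⟩ | ⟨x, rfl⟩
    · exact .inl ⟨x, hs₁ hp, rfl⟩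
    · exact .inr ⟨x, hs₂ hp, rfl⟩

end CausalGluing

/-! ### The amalgamation as a causal gluing -/

section Quotient

variable {X₁ : Type u} {X₂ : Type v} {A₁ : Set X₁} {A₂ : Set X₂}

namespace Amalgam

/-- The inclusion of the first component. -/
def inl (f : A₁ → A₂) (x : X₁) : Amalgam f := Quotient.mk (glueSetoid f) (Sum.inl x)

/-- The inclusion of the second component. -/
def inr (f : A₁ → A₂) (x : X₂) : Amalgam f := Quotient.mk (glueSetoid f) (Sum.inr x)

theorem mem_range (f : A₁ → A₂) (p : Amalgam f) : p ∈ range (inl f) ∨ p ∈ range (inr f) := by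
  induction p using Quotient.inductionOn with
  | h x =>
    rcases x with x | x
    · exact .inl ⟨x, rfl⟩
    · exact .inr ⟨x, rfl⟩

theorem glue (f : A₁ → A₂) (a : A₁) : inl f a = inr f (f a) :=
  Quotient.sound (Relation.EqvGen.rel _ _ ⟨a, rfl, rfl⟩)

open Classical in
/-- The representative of a point of the disjoint union in `X₁ ⊔ (X₂ \ A₂)`. -/
noncomputable def normalForm (f : A₁ ≃ A₂) : X₁ ⊕ X₂ → X₁ ⊕ X₂
  | .inl x => .inl x
  | .inr y => if h : y ∈ A₂ then .inl (f.symm ⟨y, h⟩) else .inr y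

/-- The normal form agrees on the generating pairs, hence on whole classes. As an invariant it tells
which points the gluing identifies. -/
theorem normalForm_eq (f : A₁ ≃ A₂) {p q : X₁ ⊕ X₂}
    (h : Quotient.mk (glueSetoid f) p = Quotient.mk (glueSetoid f) q) :
    normalForm f p = normalForm f q := by
  have h' : Relation.EqvGen _ p q := Quotient.exact h
  clear h
  induction h' with
  | rel p q h =>
    obtain ⟨a, rfl, rfl⟩ := h
    simp [normalForm]
  | refl p => rfl
  | symm p q _ ih => exact ih.symm
  | trans p q r _ _ ih ih' => exact ih.trans ih'

theorem inl_injective (f : A₁ ≃ A₂) : Function.Injective (inl f) := fun _ _ h =>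
  Sum.inl_injective (normalForm_eq f h)

theorem inl_eq_inr_iff (f : A₁ ≃ A₂) {x : X₁} {y : X₂} :
    inl f x = inr f y ↔ ∃ a : A₁, (a : X₁) = x ∧ (f a : X₂) = y := by
  constructor
  · intro h
    have h' := normalForm_eq f h
    by_cases hy : y ∈ A₂
    · simp only [normalForm, dif_pos hy, Sum.inl.injEq] at h'
      exact ⟨f.symm ⟨y, hy⟩, h'.symm, by simp⟩
    · simp [normalForm, dif_neg hy] at h'
  · rintro ⟨a, rfl, rfl⟩
    exact glue f a

theorem inr_injective (f : A₁ ≃ A₂) : Function.Injective (inr f) := by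
  intro x y h
  have h' := normalForm_eq f h
  by_cases hx : x ∈ A₂ <;> by_cases hy : y ∈ A₂ <;> simp_all [normalForm]
  exact congrArg Subtype.val (f.symm.injective (Subtype.ext h'))

theorem preimage_range_inr (f : A₁ ≃ A₂) : inl f ⁻¹' range (inr f) = A₁ := by
  ext x
  constructor
  · rintro ⟨y, hy⟩
    obtain ⟨a, rfl, -⟩ := (inl_eq_inr_iff f).1 hy.symm
    exact a.2
  · exact fun hx => ⟨f ⟨x, hx⟩, (glue f ⟨x, hx⟩).symm⟩

theorem preimage_range_inl (f : A₁ ≃ A₂) : inr f ⁻¹' range (inl f) = A₂ := by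
  ext y
  constructor
  · rintro ⟨x, hx⟩
    obtain ⟨a, -, rfl⟩ := (inl_eq_inr_iff f).1 hx
    exact (f a).2
  · intro hy
    exact ⟨f.symm ⟨y, hy⟩, (glue f _).trans (by simp)⟩

/-! ### Causality -/

/-- The possible forms of a reduced causal chain from `p` to `q` whose length is at least `r`. -/
inductive Reduced [PreLengthSpace X₁] [PreLengthSpace X₂] (f : A₁ → A₂) :
    Amalgam f → Amalgam f → ℝ≥0∞ → Prop
  | left (x y : X₁) (r : ℝ≥0∞) (h : Caus x y) (hr : r ≤ tau x y) : Reduced f (inl f x) (inl f y) r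
  | right (x y : X₂) (r : ℝ≥0∞) (h : Caus x y) (hr : r ≤ tau x y) : Reduced f (inr f x) (inr f y) r
  | leftRight (x : X₁) (a : A₁) (y : X₂) (r : ℝ≥0∞) (h : Caus x a) (h' : Caus (f a : X₂) y)
      (hr : r ≤ tau x (a : X₁) + tau (f a : X₂) y) : Reduced f (inl f x) (inr f y) r
  | rightLeft (x : X₂) (a : A₁) (y : X₁) (r : ℝ≥0∞) (h : Caus x (f a : X₂)) (h' : Caus (a : X₁) y)
      (hr : r ≤ tau x (f a : X₂) + tau (a : X₁) y) : Reduced f (inr f x) (inl f y) r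

variable [PreLengthSpace X₁] [PreLengthSpace X₂]

theorem tau_add_le {X : Type u} [PreLengthSpace X] {x y z : X} {r : ℝ≥0∞} (h : Caus x y)
    (h' : Caus y z) (hr : r ≤ tau y z) : tau x y + r ≤ tau x z :=
  (add_le_add_right hr _).trans (tau_triangle _ _ _ h h')

/-- Prepending a link never creates a second crossing: in the case `rightLeft` the excursion into
`X₂` runs between points of `A₂`, and `f` transfers it to `X₁` with the same `τ`. -/
theorem Reduced.cons_left {f : A₁ ≃ A₂}
    (ht : ∀ a b : A₁, tau (a : X₁) (b : X₁) = tau (f a : X₂) (f b : X₂))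
    (hc : ∀ a b : A₁, Caus (a : X₁) (b : X₁) ↔ Caus (f a : X₂) (f b : X₂)) {x y : X₁}
    (hxy : Caus x y) {p q : Amalgam f} {r : ℝ≥0∞} (h : Reduced f p q r) (hp : p = inl f y) :
    Reduced f (inl f x) q (tau x y + r) := by
  cases h with
  | left y' z r h hr =>
    obtain rfl := inl_injective f hp
    exact .left _ _ _ (caus_trans _ _ _ hxy h) (tau_add_le hxy h hr)
  | right y' z r h hr =>
    obtain ⟨a, rfl, rfl⟩ := (inl_eq_inr_iff f).1 hp.symm
    exact .leftRight _ a _ _ hxy h (by gcongr)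
  | leftRight y' a z r h h' hr =>
    obtain rfl := inl_injective f hp
    refine .leftRight _ a _ _ (caus_trans _ _ _ hxy h) h' ?_
    calc tau x y' + r ≤ tau x y' + (tau y' (a : X₁) + tau (f a : X₂) z) := by gcongr
      _ ≤ _ := by
        rw [← add_assoc]
        gcongr
        exact tau_triangle _ _ _ hxy h
  | rightLeft y' a z r h h' hr =>
    obtain ⟨b, rfl, rfl⟩ := (inl_eq_inr_iff f).1 hp.symm
    rw [← hc] at h
    rw [← ht] at hr
    have hbz : Caus (b : X₁) z := caus_trans _ _ _ h h'
    exact .left _ _ _ (caus_trans _ _ _ hxy hbz)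
      (tau_add_le hxy hbz (hr.trans (tau_triangle _ _ _ h h')))

theorem Reduced.cons_right {f : A₁ ≃ A₂}
    (ht : ∀ a b : A₁, tau (a : X₁) (b : X₁) = tau (f a : X₂) (f b : X₂))
    (hc : ∀ a b : A₁, Caus (a : X₁) (b : X₁) ↔ Caus (f a : X₂) (f b : X₂)) {x y : X₂}
    (hxy : Caus x y) {p q : Amalgam f} {r : ℝ≥0∞} (h : Reduced f p q r) (hp : p = inr f y) :
    Reduced f (inr f x) q (tau x y + r) := by
  cases h with
  | left y' z r h hr =>
    obtain ⟨a, rfl, rfl⟩ := (inl_eq_inr_iff f).1 hp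
    exact .rightLeft _ a _ _ hxy h (by gcongr)
  | right y' z r h hr =>
    obtain rfl := inr_injective f hp
    exact .right _ _ _ (caus_trans _ _ _ hxy h) (tau_add_le hxy h hr)
  | leftRight y' a z r h h' hr =>
    obtain ⟨b, rfl, rfl⟩ := (inl_eq_inr_iff f).1 hp
    rw [hc] at h
    rw [ht] at hr
    have hbz : Caus (f b : X₂) z := caus_trans _ _ _ h h'
    exact .right _ _ _ (caus_trans _ _ _ hxy hbz)
      (tau_add_le hxy hbz (hr.trans (tau_triangle _ _ _ h h')))
  | rightLeft y' a z r h h' hr =>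
    obtain rfl := inr_injective f hp
    refine .rightLeft _ a _ _ (caus_trans _ _ _ hxy h) h' ?_
    calc tau x y' + r ≤ tau x y' + (tau y' (f a : X₂) + tau (a : X₁) z) := by gcongr
      _ ≤ _ := by
        rw [← add_assoc]
        gcongr
        exact tau_triangle _ _ _ hxy h

theorem reduced_of_quotChain {f : A₁ ≃ A₂}
    (ht : ∀ a b : A₁, tau (a : X₁) (b : X₁) = tau (f a : X₂) (f b : X₂))
    (hc : ∀ a b : A₁, Caus (a : X₁) (b : X₁) ↔ Caus (f a : X₂) (f b : X₂)) {p q : Amalgam f}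
    {r : ℝ≥0∞} (h : QuotChain (glueSetoid f) sumCaus sumTau p q r) : Reduced f p q r := by
  induction h with
  | single x y h =>
    rcases x with x | x <;> rcases y with y | y
    · exact .left x y _ h le_rfl
    · exact h.elim
    · exact h.elim
    · exact .right x y _ h le_rfl
  | cons x y h q r t ih =>
    rcases x with x | x <;> rcases y with y | y
    · exact ih.cons_left ht hc h rfl
    · exact h.elim
    · exact h.elim
    · exact ih.cons_right ht hc h rfl

theorem quotChain_of_reduced {f : A₁ ≃ A₂} {p q : Amalgam f} {r : ℝ≥0∞} (h : Reduced f p q r) :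
    ∃ r', r ≤ r' ∧ QuotChain (glueSetoid f) sumCaus sumTau p q r' := by
  cases h with
  | left x y r h hr => exact ⟨_, hr, .single (Sum.inl x) (Sum.inl y) h⟩
  | right x y r h hr => exact ⟨_, hr, .single (Sum.inr x) (Sum.inr y) h⟩
  | leftRight x a y r h h' hr =>
    have h₁ : QuotChain (glueSetoid f) sumCaus sumTau (inl f x) (inl f a) (tau x (a : X₁)) :=
      .single (Sum.inl x) (Sum.inl (a : X₁)) h
    have h₂ : QuotChain (glueSetoid f) sumCaus sumTau (inr f (f a)) (inr f y)
      (tau (f a : X₂) y) := .single (Sum.inr (f a : X₂)) (Sum.inr y) h'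
    rw [← glue f a] at h₂
    exact ⟨_, hr, h₁.append h₂⟩
  | rightLeft x a y r h h' hr =>
    have h₁ : QuotChain (glueSetoid f) sumCaus sumTau (inr f x) (inr f (f a))
      (tau x (f a : X₂)) := .single (Sum.inr x) (Sum.inr (f a : X₂)) h
    have h₂ : QuotChain (glueSetoid f) sumCaus sumTau (inl f a) (inl f y) (tau (a : X₁) y) :=
      .single (Sum.inl (a : X₁)) (Sum.inl y) h'
    rw [← glue f a] at h₁
    exact ⟨_, hr, h₁.append h₂⟩

/-- Endpoints are given by equations because a point of `A` has a name in each component, so all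
four forms can occur; `f` translates them back to `X₁`. -/
theorem Reduced.inl_inl {f : A₁ ≃ A₂}
    (ht : ∀ a b : A₁, tau (a : X₁) (b : X₁) = tau (f a : X₂) (f b : X₂))
    (hc : ∀ a b : A₁, Caus (a : X₁) (b : X₁) ↔ Caus (f a : X₂) (f b : X₂)) {x y : X₁}
    {p q : Amalgam f} {r : ℝ≥0∞} (h : Reduced f p q r) (hp : p = inl f x) (hq : q = inl f y) :
    Caus x y ∧ r ≤ tau x y := by
  cases h with
  | left x' y' r h hr =>
    rw [← inl_injective f hp, ← inl_injective f hq]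
    exact ⟨h, hr⟩
  | right x' y' r h hr =>
    obtain ⟨a, rfl, rfl⟩ := (inl_eq_inr_iff f).1 hp.symm
    obtain ⟨b, rfl, rfl⟩ := (inl_eq_inr_iff f).1 hq.symm
    rw [← hc] at h
    rw [← ht] at hr
    exact ⟨h, hr⟩
  | leftRight x' a y' r h h' hr =>
    obtain ⟨b, rfl, rfl⟩ := (inl_eq_inr_iff f).1 hq.symm
    rw [← inl_injective f hp]
    rw [← hc] at h'
    rw [← ht] at hr
    exact ⟨caus_trans _ _ _ h h', hr.trans (tau_triangle _ _ _ h h')⟩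
  | rightLeft x' a y' r h h' hr =>
    obtain ⟨b, rfl, rfl⟩ := (inl_eq_inr_iff f).1 hp.symm
    rw [← inl_injective f hq]
    rw [← hc] at h
    rw [← ht] at hr
    exact ⟨caus_trans _ _ _ h h', hr.trans (tau_triangle _ _ _ h h')⟩

/-- In the forms other than `leftRight` an endpoint lies in `A` and itself serves as the mediating
point, with a reflexive relation on one side. -/
theorem Reduced.inl_inr {f : A₁ ≃ A₂}
    (ht : ∀ a b : A₁, tau (a : X₁) (b : X₁) = tau (f a : X₂) (f b : X₂))
    (hc : ∀ a b : A₁, Caus (a : X₁) (b : X₁) ↔ Caus (f a : X₂) (f b : X₂)) {x : X₁} {y : X₂}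
    {p q : Amalgam f} {r : ℝ≥0∞} (h : Reduced f p q r) (hp : p = inl f x) (hq : q = inr f y) :
    ∃ a : A₁, Caus x a ∧ Caus (f a : X₂) y ∧ r ≤ tau x (a : X₁) + tau (f a : X₂) y := by
  cases h with
  | left x' y' r h hr =>
    obtain ⟨b, rfl, rfl⟩ := (inl_eq_inr_iff f).1 hq
    rw [← inl_injective f hp]
    exact ⟨b, h, caus_refl _, hr.trans le_self_add⟩
  | right x' y' r h hr =>
    obtain ⟨a, rfl, rfl⟩ := (inl_eq_inr_iff f).1 hp.symm
    rw [← inr_injective f hq]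
    exact ⟨a, caus_refl _, h, hr.trans le_add_self⟩
  | leftRight x' a y' r h h' hr =>
    rw [← inl_injective f hp, ← inr_injective f hq]
    exact ⟨a, h, h', hr⟩
  | rightLeft x' a y' r h h' hr =>
    obtain ⟨b, rfl, rfl⟩ := (inl_eq_inr_iff f).1 hp.symm
    obtain ⟨c, rfl, rfl⟩ := (inl_eq_inr_iff f).1 hq
    rw [← hc] at h
    rw [← ht] at hr
    exact ⟨c, caus_trans _ _ _ h h', caus_refl _,
      (hr.trans (tau_triangle _ _ _ h h')).trans le_self_add⟩

theorem Reduced.inr_inr {f : A₁ ≃ A₂}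
    (ht : ∀ a b : A₁, tau (a : X₁) (b : X₁) = tau (f a : X₂) (f b : X₂))
    (hc : ∀ a b : A₁, Caus (a : X₁) (b : X₁) ↔ Caus (f a : X₂) (f b : X₂)) {x y : X₂}
    {p q : Amalgam f} {r : ℝ≥0∞} (h : Reduced f p q r) (hp : p = inr f x) (hq : q = inr f y) :
    Caus x y ∧ r ≤ tau x y := by
  cases h with
  | left x' y' r h hr =>
    obtain ⟨a, rfl, rfl⟩ := (inl_eq_inr_iff f).1 hp
    obtain ⟨b, rfl, rfl⟩ := (inl_eq_inr_iff f).1 hq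
    rw [hc] at h
    rw [ht] at hr
    exact ⟨h, hr⟩
  | right x' y' r h hr =>
    rw [← inr_injective f hp, ← inr_injective f hq]
    exact ⟨h, hr⟩
  | leftRight x' a y' r h h' hr =>
    obtain ⟨b, rfl, rfl⟩ := (inl_eq_inr_iff f).1 hp
    rw [← inr_injective f hq]
    rw [hc] at h
    rw [ht] at hr
    exact ⟨caus_trans _ _ _ h h', hr.trans (tau_triangle _ _ _ h h')⟩
  | rightLeft x' a y' r h h' hr =>
    obtain ⟨b, rfl, rfl⟩ := (inl_eq_inr_iff f).1 hq
    rw [← inr_injective f hp]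
    rw [hc] at h'
    rw [ht] at hr
    exact ⟨caus_trans _ _ _ h h', hr.trans (tau_triangle _ _ _ h h')⟩

theorem Reduced.inr_inl {f : A₁ ≃ A₂}
    (ht : ∀ a b : A₁, tau (a : X₁) (b : X₁) = tau (f a : X₂) (f b : X₂))
    (hc : ∀ a b : A₁, Caus (a : X₁) (b : X₁) ↔ Caus (f a : X₂) (f b : X₂)) {x : X₂} {y : X₁}
    {p q : Amalgam f} {r : ℝ≥0∞} (h : Reduced f p q r) (hp : p = inr f x) (hq : q = inl f y) :
    ∃ a : A₁, Caus x (f a) ∧ Caus (a : X₁) y ∧ r ≤ tau x (f a : X₂) + tau (a : X₁) y := by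
  cases h with
  | left x' y' r h hr =>
    obtain ⟨a, rfl, rfl⟩ := (inl_eq_inr_iff f).1 hp
    rw [← inl_injective f hq]
    exact ⟨a, caus_refl _, h, hr.trans le_add_self⟩
  | right x' y' r h hr =>
    obtain ⟨b, rfl, rfl⟩ := (inl_eq_inr_iff f).1 hq.symm
    rw [← inr_injective f hp]
    exact ⟨b, h, caus_refl _, hr.trans le_self_add⟩
  | leftRight x' a y' r h h' hr =>
    obtain ⟨b, rfl, rfl⟩ := (inl_eq_inr_iff f).1 hp
    obtain ⟨c, rfl, rfl⟩ := (inl_eq_inr_iff f).1 hq.symm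
    rw [hc] at h
    rw [ht] at hr
    exact ⟨c, caus_trans _ _ _ h h', caus_refl _,
      (hr.trans (tau_triangle _ _ _ h h')).trans le_self_add⟩
  | rightLeft x' a y' r h h' hr =>
    rw [← inr_injective f hp, ← inl_injective f hq]
    exact ⟨a, h, h', hr⟩

end Amalgam

namespace GluingData

variable [PreLengthSpace X₁] [PreLengthSpace X₂] {f : A₁ ≃ₜ A₂}

open Amalgam

theorem caus_iff_reduced (hf : GluingData A₁ A₂ f) {p q : Amalgam f} :
    Caus p q ↔ Reduced f p q 0 := by
  constructor
  · rintro ⟨r, hr⟩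
    have h := reduced_of_quotChain (f := f.toEquiv) hf.tau_eq hf.caus_iff hr
    cases h with
    | left x y r h hr => exact .left x y _ h zero_le
    | right x y r h hr => exact .right x y _ h zero_le
    | leftRight x a y r h h' hr => exact .leftRight x a y _ h h' zero_le
    | rightLeft x a y r h h' hr => exact .rightLeft x a y _ h h' zero_le
  · intro h
    obtain ⟨r, -, hr⟩ := quotChain_of_reduced (f := f.toEquiv) h
    exact ⟨r, hr⟩

theorem chron_iff_reduced (hf : GluingData A₁ A₂ f) {p q : Amalgam f} :
    Chron p q ↔ ∃ r > 0, Reduced f p q r := by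
  change 0 < sSup _ ↔ _
  rw [lt_sSup_iff]
  constructor
  · rintro ⟨r, hr, h⟩
    exact ⟨r, h, reduced_of_quotChain (f := f.toEquiv) hf.tau_eq hf.caus_iff hr⟩
  · rintro ⟨r, h, hr⟩
    obtain ⟨r', hrr', hr'⟩ := quotChain_of_reduced (f := f.toEquiv) hr
    exact ⟨r', hr', lt_of_lt_of_le h hrr'⟩

theorem symm (hf : GluingData A₁ A₂ f) : GluingData A₂ A₁ f.symm where
  closed₁ := hf.closed₂
  closed₂ := hf.closed₁
  isolating₁ := hf.isolating₂
  isolating₂ := hf.isolating₁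
  biLipschitz c := by
    obtain ⟨U, hU, h, h'⟩ := hf.biLipschitz (f.symm c)
    refine ⟨f '' U, ?_, h', ?_⟩
    · rw [f.image_eq_preimage_symm]
      exact f.symm.continuous.continuousAt.preimage_mem_nhds hU
    · rw [f.symm.image_eq_preimage_symm, f.symm_symm, f.preimage_image]
      exact h
  future_iff a := by simpa using (hf.future_iff (f.symm a)).symm
  past_iff a := by simpa using (hf.past_iff (f.symm a)).symm
  tau_eq a b := by simpa using (hf.tau_eq (f.symm a) (f.symm b)).symm
  caus_iff a b := by simpa using (hf.caus_iff (f.symm a) (f.symm b)).symm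

/-- A positive sum makes only one factor timelike. Moving the mediating point slightly within `A`,
into the past if the first factor is timelike and into the future otherwise, makes the other factor
timelike and keeps the first so. -/
theorem exists_chron_chron (hf : GluingData A₁ A₂ f) {x : X₁} {a : A₁} {y : X₂} (h : Caus x a)
    (h' : Caus (f a : X₂) y) (hpos : 0 < tau x (a : X₁) + tau (f a : X₂) y) :
    ∃ b : A₁, Chron x b ∧ Chron (f b : X₂) y := by
  have hchron : ∀ b c : A₁, Chron (b : X₁) (c : X₁) ↔ Chron (f b : X₂) (f c : X₂) := fun b c => by
    rw [← tau_pos_iff, ← tau_pos_iff, hf.tau_eq]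
  rcases (add_pos_iff.1 hpos) with hp | hp
  · rw [tau_pos_iff] at hp
    obtain ⟨b, ⟨hxb, hb⟩, hba⟩ := hf.isolating₁.2 a a.2 ⟨x, hp⟩ _
      ((isOpen_chronFuture x).mem_nhds hp)
    exact ⟨⟨b, hb⟩, hxb, chron_caus_trans ((hchron ⟨b, hb⟩ a).1 hba) h'⟩
  · rw [tau_pos_iff] at hp
    obtain ⟨c, ⟨hcy, hc⟩, hac⟩ := hf.isolating₂.1 (f a) (f a).2 ⟨y, hp⟩ _
      ((isOpen_chronPast y).mem_nhds hp)
    refine ⟨f.symm ⟨c, hc⟩, caus_chron_trans h ((hchron _ _).2 ?_), ?_⟩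
    · simpa using hac
    · rw [f.apply_symm_apply]
      exact hcy

end GluingData

end Quotient

namespace GluingData

variable {X₁ : Type u} {X₂ : Type v} {A₁ : Set X₁} {A₂ : Set X₂}
  [PreLengthSpace X₁] [PreLengthSpace X₂] {f : A₁ ≃ₜ A₂}

open Amalgam

theorem caus_inl_inl (hf : GluingData A₁ A₂ f) (x y : X₁) :
    Caus (inl f x) (inl f y) ↔ Caus x y := by
  rw [hf.caus_iff_reduced]
  exact ⟨fun h => (h.inl_inl (f := f.toEquiv) hf.tau_eq hf.caus_iff rfl rfl).1,
    fun h => .left x y _ h zero_le⟩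

theorem caus_inr_inr (hf : GluingData A₁ A₂ f) (x y : X₂) :
    Caus (inr f x) (inr f y) ↔ Caus x y := by
  rw [hf.caus_iff_reduced]
  exact ⟨fun h => (h.inr_inr (f := f.toEquiv) hf.tau_eq hf.caus_iff rfl rfl).1,
    fun h => .right x y _ h zero_le⟩

theorem caus_inl_inr (hf : GluingData A₁ A₂ f) (x : X₁) (y : X₂) :
    Caus (inl f x) (inr f y) ↔ ∃ a b, inl f a = inr f b ∧ Caus x a ∧ Caus b y := by
  rw [hf.caus_iff_reduced]
  constructor
  · intro h
    obtain ⟨a, hxa, hay, -⟩ := h.inl_inr (f := f.toEquiv) hf.tau_eq hf.caus_iff rfl rfl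
    exact ⟨a, f a, glue f a, hxa, hay⟩
  · rintro ⟨_, _, hab, hxa, hby⟩
    obtain ⟨a, rfl, rfl⟩ := (inl_eq_inr_iff f.toEquiv).1 hab
    exact .leftRight x a y _ hxa hby zero_le

theorem caus_inr_inl (hf : GluingData A₁ A₂ f) (x : X₂) (y : X₁) :
    Caus (inr f x) (inl f y) ↔ ∃ a b, inr f a = inl f b ∧ Caus x a ∧ Caus b y := by
  rw [hf.caus_iff_reduced]
  constructor
  · intro h
    obtain ⟨a, hxa, hay, -⟩ := h.inr_inl (f := f.toEquiv) hf.tau_eq hf.caus_iff rfl rfl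
    exact ⟨f a, a, (glue f a).symm, hxa, hay⟩
  · rintro ⟨_, _, hab, hxa, hby⟩
    obtain ⟨a, rfl, rfl⟩ := (inl_eq_inr_iff f.toEquiv).1 hab.symm
    exact .rightLeft x a y _ hxa hby zero_le

theorem chron_inl_inl (hf : GluingData A₁ A₂ f) (x y : X₁) :
    Chron (inl f x) (inl f y) ↔ Chron x y := by
  rw [hf.chron_iff_reduced, ← tau_pos_iff]
  constructor
  · rintro ⟨r, hr, h⟩
    exact lt_of_lt_of_le hr (h.inl_inl (f := f.toEquiv) hf.tau_eq hf.caus_iff rfl rfl).2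
  · exact fun h => ⟨_, h, .left x y _ (chron_caus _ _ ((tau_pos_iff _ _).1 h)) le_rfl⟩

theorem chron_inr_inr (hf : GluingData A₁ A₂ f) (x y : X₂) :
    Chron (inr f x) (inr f y) ↔ Chron x y := by
  rw [hf.chron_iff_reduced, ← tau_pos_iff]
  constructor
  · rintro ⟨r, hr, h⟩
    exact lt_of_lt_of_le hr (h.inr_inr (f := f.toEquiv) hf.tau_eq hf.caus_iff rfl rfl).2
  · exact fun h => ⟨_, h, .right x y _ (chron_caus _ _ ((tau_pos_iff _ _).1 h)) le_rfl⟩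

theorem chron_inl_inr (hf : GluingData A₁ A₂ f) (x : X₁) (y : X₂) :
    Chron (inl f x) (inr f y) ↔ ∃ a b, inl f a = inr f b ∧ Chron x a ∧ Chron b y := by
  rw [hf.chron_iff_reduced]
  constructor
  · rintro ⟨r, hr, h⟩
    obtain ⟨a, hxa, hay, hle⟩ := h.inl_inr (f := f.toEquiv) hf.tau_eq hf.caus_iff rfl rfl
    obtain ⟨b, hxb, hby⟩ := hf.exists_chron_chron hxa hay (lt_of_lt_of_le hr hle)
    exact ⟨b, f b, glue f b, hxb, hby⟩
  · rintro ⟨_, _, hab, hxa, hby⟩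
    obtain ⟨a, rfl, rfl⟩ := (inl_eq_inr_iff f.toEquiv).1 hab
    exact ⟨_, add_pos_of_pos_of_nonneg ((tau_pos_iff _ _).2 hxa) zero_le,
      .leftRight x a y _ (chron_caus _ _ hxa) (chron_caus _ _ hby) le_rfl⟩

theorem chron_inr_inl (hf : GluingData A₁ A₂ f) (x : X₂) (y : X₁) :
    Chron (inr f x) (inl f y) ↔ ∃ a b, inr f a = inl f b ∧ Chron x a ∧ Chron b y := by
  rw [hf.chron_iff_reduced]
  constructor
  · rintro ⟨r, hr, h⟩
    obtain ⟨a, hxa, hay, hle⟩ := h.inr_inl (f := f.toEquiv) hf.tau_eq hf.caus_iff rfl rfl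
    obtain ⟨b, hxb, hby⟩ := hf.symm.exists_chron_chron (a := f a) hxa (by simpa using hay)
      (lt_of_lt_of_le hr (by simpa using hle))
    exact ⟨b, f.symm b, by simp [glue], hxb, hby⟩
  · rintro ⟨_, _, hab, hxa, hby⟩
    obtain ⟨a, rfl, rfl⟩ := (inl_eq_inr_iff f.toEquiv).1 hab.symm
    exact ⟨_, add_pos_of_pos_of_nonneg ((tau_pos_iff _ _).2 hxa) zero_le,
      .rightLeft x a y _ (chron_caus _ _ hxa) (chron_caus _ _ hby) le_rfl⟩

/-! ### Topology -/

theorem edist_lt_iff {p q : Amalgam f} {ε : ℝ≥0∞} : edist p q < ε ↔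
    ∃ r, QuotChain (glueSetoid f) (fun _ _ => True) sumDist p q r ∧ r < ε :=
  sInf_lt_iff

/-- A chain shorter than the distance from `x` to `A₁` never reaches `A₁`, so it cannot change
component. The induction carries the distance covered plus the remaining length. -/
theorem exists_eq_inl_of_quotChain {x : X₁} {ε : ℝ≥0∞} (hx : ∀ z ∈ A₁, ε ≤ edist x z)
    {p q : Amalgam f} {r : ℝ≥0∞} (h : QuotChain (glueSetoid f) (fun _ _ => True) sumDist p q r) :
    ∀ z, p = inl f z → edist x z + r < ε → ∃ w, q = inl f w ∧ edist x w < ε := by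
  have step : ∀ (x' y' : X₁ ⊕ X₂) (z : X₁) (s : ℝ≥0∞), Quotient.mk (glueSetoid f) x' = inl f z →
      edist x z + (sumDist x' y' + s) < ε → ∃ w, y' = Sum.inl w ∧ edist x w + s < ε := by
    intro x' y' z s hz hlt
    rcases x' with x' | x'
    · obtain rfl := inl_injective f.toEquiv hz
      rcases y' with y' | y'
      · refine ⟨y', rfl, lt_of_le_of_lt ?_ hlt⟩
        rw [← add_assoc]
        gcongr
        exact edist_triangle _ _ _
      · simp [sumDist] at hlt
    · obtain ⟨a, rfl, -⟩ := (inl_eq_inr_iff f.toEquiv).1 hz.symm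
      exact absurd (lt_of_le_of_lt le_self_add hlt) (hx a a.2).not_gt
  induction h with
  | single x' y' _ =>
    intro z hz hlt
    obtain ⟨w, rfl, hw⟩ := step x' y' z 0 hz (by simpa using hlt)
    exact ⟨w, rfl, by simpa using hw⟩
  | cons x' y' _ q r t ih =>
    intro z hz hlt
    obtain ⟨w, rfl, hw⟩ := step x' y' z r hz hlt
    exact ih w rfl hw

theorem exists_eq_inr_of_quotChain {x : X₂} {ε : ℝ≥0∞} (hx : ∀ z ∈ A₂, ε ≤ edist x z)
    {p q : Amalgam f} {r : ℝ≥0∞} (h : QuotChain (glueSetoid f) (fun _ _ => True) sumDist p q r) :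
    ∀ z, p = inr f z → edist x z + r < ε → ∃ w, q = inr f w ∧ edist x w < ε := by
  have step : ∀ (x' y' : X₁ ⊕ X₂) (z : X₂) (s : ℝ≥0∞), Quotient.mk (glueSetoid f) x' = inr f z →
      edist x z + (sumDist x' y' + s) < ε → ∃ w, y' = Sum.inr w ∧ edist x w + s < ε := by
    intro x' y' z s hz hlt
    rcases x' with x' | x'
    · obtain ⟨a, -, rfl⟩ := (inl_eq_inr_iff f.toEquiv).1 hz
      exact absurd (lt_of_le_of_lt le_self_add hlt) (hx (f a) (f a).2).not_gt
    · obtain rfl := inr_injective f.toEquiv hz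
      rcases y' with y' | y'
      · simp [sumDist] at hlt
      · refine ⟨y', rfl, lt_of_le_of_lt ?_ hlt⟩
        rw [← add_assoc]
        gcongr
        exact edist_triangle _ _ _
  induction h with
  | single x' y' _ =>
    intro z hz hlt
    obtain ⟨w, rfl, hw⟩ := step x' y' z 0 hz (by simpa using hlt)
    exact ⟨w, rfl, by simpa using hw⟩
  | cons x' y' _ q r t ih =>
    intro z hz hlt
    obtain ⟨w, rfl, hw⟩ := step x' y' z r hz hlt
    exact ih w rfl hw

/-- The point `p` is reached from `a` by a chain of length at most `s` through `A` up to a point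
`c`, followed by a path in a single component. -/
def ReachedWithin (f : A₁ ≃ₜ A₂) (K : ℝ≥0∞) (a : A₁) (p : Amalgam f) (s : ℝ≥0∞) : Prop :=
  ∃ (c : A₁) (s₀ s₁ : ℝ≥0∞), s₀ + s₁ ≤ s ∧ edist a c ≤ K * s₀ ∧ edist (f a) (f c) ≤ K * s₀ ∧
    ((∃ z : X₁, p = inl f z ∧ edist (c : X₁) z ≤ s₁) ∨
      ∃ z : X₂, p = inr f z ∧ edist (f c : X₂) z ≤ s₁)

theorem add_le_mul_add {K s t u : ℝ≥0∞} (hK : 1 ≤ K) (h : s + t ≤ u) : K * s + t ≤ K * u :=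
  calc K * s + t ≤ K * s + K * t := by
        gcongr
        exact le_mul_of_one_le_left' hK
    _ = K * (s + t) := (mul_add _ _ _).symm
    _ ≤ K * u := by gcongr

/-- If the chain stays in its component, the tail `s₁` grows. If it switches at `b ∈ A`, the tail
from `c` to `b` is absorbed into `s₀`: in its own metric because `1 ≤ K`, in the other by the
Lipschitz bound. Each piece is thus multiplied by `K` only once, however often the chain crosses. -/
theorem ReachedWithin.step {K ε : ℝ≥0∞} {a : A₁} (hK : 1 ≤ K)
    (h₁ : ∀ b c : A₁, edist a b < ε → edist a c < ε → edist (f b) (f c) ≤ K * edist b c)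
    (h₂ : ∀ b c : A₁, edist (f a) (f b) < ε → edist (f a) (f c) < ε →
      edist b c ≤ K * edist (f b) (f c)) {x y : X₁ ⊕ X₂} {s : ℝ≥0∞}
    (h : ReachedWithin f K a (Quotient.mk (glueSetoid f) x) s)
    (hs : K * (s + sumDist x y) < ε) :
    ReachedWithin f K a (Quotient.mk (glueSetoid f) y) (s + sumDist x y) := by
  obtain ⟨c, s₀, s₁, hle, hac, hfac, hz⟩ := h
  have hsε : K * s < ε := lt_of_le_of_lt (by gcongr; exact le_self_add) hs
  have hK₀ : K * s₀ ≤ K * s := by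
    gcongr
    exact le_self_add.trans hle
  have hs₁ : K * s₀ + s₁ ≤ K * s := add_le_mul_add hK hle
  have hs₁' : K * s₀ + s₁ ≤ K * (s₀ + s₁) := add_le_mul_add hK le_rfl
  rcases x with x | x <;> rcases y with y | y
  · rcases hz with ⟨z, hxz, hcz⟩ | ⟨z, hxz, hcz⟩
    · obtain rfl := inl_injective f.toEquiv hxz
      refine ⟨c, s₀, s₁ + edist x y, ?_, hac, hfac, .inl ⟨y, rfl, ?_⟩⟩
      · rw [← add_assoc]
        exact add_le_add_left hle _
      · exact (edist_triangle _ x _).trans (add_le_add_left hcz _)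
    · obtain ⟨b, rfl, rfl⟩ := (inl_eq_inr_iff f.toEquiv).1 hxz
      have hcz' : edist (f c) (f b) ≤ s₁ := hcz
      have hfab : edist (f a) (f b) ≤ K * s₀ + s₁ :=
        (edist_triangle _ (f c) _).trans (add_le_add hfac hcz')
      refine ⟨b, s₀ + s₁, edist (b : X₁) y, add_le_add_left hle _, ?_, hfab.trans hs₁',
        .inl ⟨y, rfl, le_rfl⟩⟩
      refine (edist_triangle _ c _).trans ?_
      rw [mul_add]
      refine add_le_add hac ((h₂ c b (lt_of_le_of_lt (hfac.trans hK₀) hsε)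
        (lt_of_le_of_lt (hfab.trans hs₁) hsε)).trans ?_)
      gcongr
  · simp [sumDist, ENNReal.mul_top (zero_lt_one.trans_le hK).ne'] at hs
  · simp [sumDist, ENNReal.mul_top (zero_lt_one.trans_le hK).ne'] at hs
  · rcases hz with ⟨z, hxz, hcz⟩ | ⟨z, hxz, hcz⟩
    · obtain ⟨b, rfl, rfl⟩ := (inl_eq_inr_iff f.toEquiv).1 hxz.symm
      have hcz' : edist c b ≤ s₁ := hcz
      have hab : edist a b ≤ K * s₀ + s₁ :=
        (edist_triangle _ c _).trans (add_le_add hac hcz')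
      refine ⟨b, s₀ + s₁, edist (f b : X₂) y, add_le_add_left hle _, hab.trans hs₁', ?_,
        .inr ⟨y, rfl, le_rfl⟩⟩
      refine (edist_triangle _ (f c) _).trans ?_
      rw [mul_add]
      refine add_le_add hfac ((h₁ c b (lt_of_le_of_lt (hac.trans hK₀) hsε)
        (lt_of_le_of_lt (hab.trans hs₁) hsε)).trans ?_)
      gcongr
    · obtain rfl := inr_injective f.toEquiv hxz
      refine ⟨c, s₀, s₁ + edist x y, ?_, hac, hfac, .inr ⟨y, rfl, ?_⟩⟩
      · rw [← add_assoc]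
        exact add_le_add_left hle _
      · exact (edist_triangle _ x _).trans (add_le_add_left hcz _)

theorem ReachedWithin.of_quotChain {K ε : ℝ≥0∞} {a : A₁} (hK : 1 ≤ K)
    (h₁ : ∀ b c : A₁, edist a b < ε → edist a c < ε → edist (f b) (f c) ≤ K * edist b c)
    (h₂ : ∀ b c : A₁, edist (f a) (f b) < ε → edist (f a) (f c) < ε →
      edist b c ≤ K * edist (f b) (f c)) {p q : Amalgam f} {r : ℝ≥0∞}
    (h : QuotChain (glueSetoid f) (fun _ _ => True) sumDist p q r) :
    ∀ s, ReachedWithin f K a p s → K * (s + r) < ε → ReachedWithin f K a q (s + r) := by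
  induction h with
  | single x y _ => exact fun s hp hs => hp.step hK h₁ h₂ hs
  | cons x y _ q r t ih =>
    intro s hp hs
    rw [← add_assoc] at hs ⊢
    refine ih _ (hp.step hK h₁ h₂ (lt_of_le_of_lt ?_ hs)) hs
    gcongr K * ?_
    exact le_self_add

theorem exists_lipschitz_radius (hf : GluingData A₁ A₂ f) (a : A₁) :
    ∃ K : ℝ≥0, 1 ≤ K ∧ ∃ ε > 0,
      (∀ b c : A₁, edist a b < ε → edist a c < ε → edist (f b) (f c) ≤ K * edist b c) ∧
      ∀ b c : A₁, edist (f a) (f b) < ε → edist (f a) (f c) < ε →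
        edist b c ≤ K * edist (f b) (f c) := by
  obtain ⟨V, hV, ⟨K₁, hK₁⟩, K₂, hK₂⟩ := hf.biLipschitz a
  obtain ⟨ε₁, hε₁, hV₁⟩ := EMetric.mem_nhds_iff.1 hV
  obtain ⟨ε₂, hε₂, hV₂⟩ := EMetric.mem_nhds_iff.1 (f.isOpenMap.image_mem_nhds hV)
  refine ⟨max 1 (max K₁ K₂), le_max_left _ _, min ε₁ ε₂, lt_min hε₁ hε₂, fun b c hb hc => ?_,
    fun b c hb hc => ?_⟩
  · rw [edist_comm, lt_min_iff] at hb hc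
    refine (hK₁ (hV₁ hb.1) (hV₁ hc.1)).trans ?_
    gcongr
    exact (le_max_left _ _).trans (le_max_right _ _)
  · rw [edist_comm, lt_min_iff] at hb hc
    have h := hK₂ (hV₂ hb.2) (hV₂ hc.2)
    rw [f.symm_apply_apply, f.symm_apply_apply] at h
    refine h.trans ?_
    gcongr
    exact (le_max_right _ _).trans (le_max_right _ _)

/-- Crossings at `A` distort lengths by at most the factor `K`, so a chain shorter than `ε / K` ends
within `ε` of the centre in the metric of whichever component it ends in. -/
theorem mem_nhds_glue (hf : GluingData A₁ A₂ f) (a : A₁) {U : Set (Amalgam f)}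
    (h₁ : inl f ⁻¹' U ∈ 𝓝 (a : X₁)) (h₂ : inr f ⁻¹' U ∈ 𝓝 (f a : X₂)) : U ∈ 𝓝 (inl f a) := by
  obtain ⟨K, hK, ε₀, hε₀, hl₁, hl₂⟩ := hf.exists_lipschitz_radius a
  obtain ⟨ε₁, hε₁, hU₁⟩ := EMetric.mem_nhds_iff.1 h₁
  obtain ⟨ε₂, hε₂, hU₂⟩ := EMetric.mem_nhds_iff.1 h₂
  let ε := min ε₀ (min ε₁ ε₂)
  have hε : 0 < ε := lt_min hε₀ (lt_min hε₁ hε₂)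
  have hK' : (1 : ℝ≥0∞) ≤ K := by exact_mod_cast hK
  refine EMetric.mem_nhds_iff.2 ⟨ε / K, ENNReal.div_pos hε.ne' ENNReal.coe_ne_top, fun q hq => ?_⟩
  have hq' : edist (inl f a) q < ε / K := by
    rw [edist_comm]
    exact hq
  obtain ⟨r, hr, hrε⟩ := edist_lt_iff.1 hq'
  have hKr : K * r < ε := ENNReal.mul_lt_of_lt_div' hrε
  have hstart : ReachedWithin f K a (inl f a) 0 :=
    ⟨a, 0, 0, by simp, by simp, by simp, .inl ⟨a, rfl, by simp⟩⟩
  have hreach := ReachedWithin.of_quotChain (ε := ε) hK'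
    (fun b c hb hc => hl₁ b c (hb.trans_le (min_le_left _ _)) (hc.trans_le (min_le_left _ _)))
    (fun b c hb hc => hl₂ b c (hb.trans_le (min_le_left _ _)) (hc.trans_le (min_le_left _ _)))
    hr 0 hstart (by simpa using hKr)
  rw [zero_add] at hreach
  obtain ⟨c, s₀, s₁, hle, hac, hfac, ⟨z, rfl, hz⟩ | ⟨z, rfl, hz⟩⟩ := hreach
  · refine hU₁ (show edist z (a : X₁) < ε₁ from ?_)
    rw [edist_comm]
    calc edist (a : X₁) z ≤ edist (a : X₁) c + edist (c : X₁) z := edist_triangle _ _ _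
      _ ≤ K * s₀ + s₁ := add_le_add hac hz
      _ ≤ K * r := add_le_mul_add hK' hle
      _ < ε := hKr
      _ ≤ ε₁ := (min_le_right _ _).trans (min_le_left _ _)
  · refine hU₂ (show edist z (f a : X₂) < ε₂ from ?_)
    rw [edist_comm]
    calc edist (f a : X₂) z ≤ edist (f a : X₂) (f c) + edist (f c : X₂) z := edist_triangle _ _ _
      _ ≤ K * s₀ + s₁ := add_le_add hfac hz
      _ ≤ K * r := add_le_mul_add hK' hle
      _ < ε := hKr
      _ ≤ ε₂ := (min_le_right _ _).trans (min_le_right _ _)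

/-- The quotient metric induces the quotient topology. Off `A` small chains stay in one component;
at `A` they are controlled by the bi-Lipschitz bounds. -/
theorem isOpen_of_preimage (hf : GluingData A₁ A₂ f) {U : Set (Amalgam f)}
    (h₁ : IsOpen (inl f ⁻¹' U)) (h₂ : IsOpen (inr f ⁻¹' U)) : IsOpen U := by
  refine isOpen_iff_mem_nhds.2 fun p hp => ?_
  rcases mem_range f p with ⟨x, rfl⟩ | ⟨x, rfl⟩
  · by_cases hx : x ∈ A₁
    · refine hf.mem_nhds_glue ⟨x, hx⟩ (h₁.mem_nhds hp) (h₂.mem_nhds ?_)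
      rwa [mem_preimage, ← glue]
    · obtain ⟨ε, hε, hU⟩ := EMetric.mem_nhds_iff.1
        ((h₁.inter hf.closed₁.isOpen_compl).mem_nhds ⟨hp, hx⟩)
      refine EMetric.mem_nhds_iff.2 ⟨ε, hε, fun q hq => ?_⟩
      obtain ⟨r, hr, hrε⟩ := edist_lt_iff.1 (show edist (inl f x) q < ε by
        rw [edist_comm]
        exact hq)
      have hA : ∀ z ∈ A₁, ε ≤ edist x z := fun z hz => not_lt.1 fun hlt =>
        (hU (show edist z x < ε by rwa [edist_comm])).2 hz
      obtain ⟨w, rfl, hw⟩ := exists_eq_inl_of_quotChain hA hr x rfl (by simpa using hrε)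
      exact (hU (show edist w x < ε by rwa [edist_comm])).1
  · by_cases hx : x ∈ A₂
    · obtain ⟨a, rfl⟩ : ∃ a, (f a : X₂) = x := ⟨f.symm ⟨x, hx⟩, by simp⟩
      have hp' : inl f a ∈ U := by rwa [glue]
      rw [← glue]
      exact hf.mem_nhds_glue a (h₁.mem_nhds hp') (h₂.mem_nhds hp)
    · obtain ⟨ε, hε, hU⟩ := EMetric.mem_nhds_iff.1
        ((h₂.inter hf.closed₂.isOpen_compl).mem_nhds ⟨hp, hx⟩)
      refine EMetric.mem_nhds_iff.2 ⟨ε, hε, fun q hq => ?_⟩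
      obtain ⟨r, hr, hrε⟩ := edist_lt_iff.1 (show edist (inr f x) q < ε by
        rw [edist_comm]
        exact hq)
      have hA : ∀ z ∈ A₂, ε ≤ edist x z := fun z hz => not_lt.1 fun hlt =>
        (hU (show edist z x < ε by rwa [edist_comm])).2 hz
      obtain ⟨w, rfl, hw⟩ := exists_eq_inr_of_quotChain hA hr x rfl (by simpa using hrε)
      exact (hU (show edist w x < ε by rwa [edist_comm])).1

theorem edist_inl_le (f : A₁ ≃ₜ A₂) (x y : X₁) : edist (inl f x) (inl f y) ≤ edist x y :=
  sInf_le (QuotChain.single (Sum.inl x) (Sum.inl y) trivial)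

theorem edist_inr_le (f : A₁ ≃ₜ A₂) (x y : X₂) : edist (inr f x) (inr f y) ≤ edist x y :=
  sInf_le (QuotChain.single (Sum.inr x) (Sum.inr y) trivial)

theorem isClosedEmbedding_inl (hf : GluingData A₁ A₂ f) : IsClosedEmbedding (inl f) := by
  have hL : LipschitzWith 1 (inl f) := fun x y => by simpa using edist_inl_le f x y
  have h_inj : Function.Injective (inl f) := inl_injective f.toEquiv
  refine .of_continuous_injective_isClosedMap hL.continuous h_inj fun C hC => ?_
  -- The trace on `X₂` is the image under `f` of `C ∩ A₁`, which is closed in `A₂` and hence in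
  -- `X₂`.
  have h₂ : inr f ⁻¹' (inl f '' C) = Subtype.val '' (f '' (Subtype.val ⁻¹' C)) := by
    ext y
    constructor
    · rintro ⟨x, hx, hxy⟩
      obtain ⟨a, rfl, rfl⟩ := (inl_eq_inr_iff f.toEquiv).1 hxy
      exact ⟨f a, ⟨a, hx, rfl⟩, rfl⟩
    · rintro ⟨_, ⟨a, ha, rfl⟩, rfl⟩
      exact ⟨a, ha, glue f a⟩
  rw [← isOpen_compl_iff]
  refine hf.isOpen_of_preimage ?_ ?_
  · rw [preimage_compl, preimage_image_eq _ h_inj]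
    exact hC.isOpen_compl
  · rw [preimage_compl, h₂]
    exact (hf.closed₂.isClosedEmbedding_subtypeVal.isClosedMap _
      (f.isClosedMap _ (hC.preimage continuous_subtype_val))).isOpen_compl

theorem isClosedEmbedding_inr (hf : GluingData A₁ A₂ f) : IsClosedEmbedding (inr f) := by
  have hL : LipschitzWith 1 (inr f) := fun x y => by simpa using edist_inr_le f x y
  have h_inj : Function.Injective (inr f) := inr_injective f.toEquiv
  refine .of_continuous_injective_isClosedMap hL.continuous h_inj fun C hC => ?_
  have h₁ : inl f ⁻¹' (inr f '' C) = Subtype.val '' (f ⁻¹' (Subtype.val ⁻¹' C)) := by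
    ext y
    constructor
    · rintro ⟨x, hx, hxy⟩
      obtain ⟨a, rfl, rfl⟩ := (inl_eq_inr_iff f.toEquiv).1 hxy.symm
      exact ⟨a, hx, rfl⟩
    · rintro ⟨a, ha, rfl⟩
      exact ⟨f a, ha, (glue f a).symm⟩
  rw [← isOpen_compl_iff]
  refine hf.isOpen_of_preimage ?_ ?_
  · rw [preimage_compl, h₁]
    exact (hf.closed₁.isClosedEmbedding_subtypeVal.isClosedMap _
      ((hC.preimage continuous_subtype_val).preimage f.continuous)).isOpen_compl
  · rw [preimage_compl, preimage_image_eq _ h_inj]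
    exact hC.isOpen_compl

theorem causalGluing (hf : GluingData A₁ A₂ f) : CausalGluing (inl f) (inr f) where
  isClosedEmbedding₁ := hf.isClosedEmbedding_inl
  isClosedEmbedding₂ := hf.isClosedEmbedding_inr
  edist_le₁ := edist_inl_le f
  edist_le₂ := edist_inr_le f
  cover := mem_range f
  caus_trans _ _ _ := fun ⟨_, h⟩ ⟨_, h'⟩ => ⟨_, h.append h'⟩
  caus₁ := hf.caus_inl_inl
  caus₂ := hf.caus_inr_inr
  caus₁₂ := hf.caus_inl_inr
  caus₂₁ := hf.caus_inr_inl
  chron₁ := hf.chron_inl_inl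
  chron₂ := hf.chron_inr_inr
  chron₁₂ := hf.chron_inl_inr
  chron₂₁ := hf.chron_inr_inl
  isolating₁ := (preimage_range_inr f.toEquiv).symm ▸ hf.isolating₁
  isolating₂ := (preimage_range_inl f.toEquiv).symm ▸ hf.isolating₂

end GluingData

end Lorentz

theorem mainTheorem1 {X₁ : Type*} {X₂ : Type*}
    [Lorentz.PreLengthSpace X₁] [Lorentz.PreLengthSpace X₂]
    (A₁ : Set X₁) (A₂ : Set X₂) (f : A₁ ≃ₜ A₂) (hf : Lorentz.GluingData A₁ A₂ f) :
    (Lorentz.Chronological X₁ → Lorentz.Chronological X₂ →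
      Lorentz.Chronological (Lorentz.Amalgam f)) ∧
    (Lorentz.Causal X₁ → Lorentz.Causal X₂ → Lorentz.Causal (Lorentz.Amalgam f)) ∧
    (Lorentz.ExtrinsicallyNonTotallyImprisoning X₁ →
      Lorentz.ExtrinsicallyNonTotallyImprisoning X₂ →
      Lorentz.NonTotallyImprisoning (Lorentz.Amalgam f)) ∧
    (Lorentz.StronglyCausal X₁ → Lorentz.StronglyCausal X₂ →
      Lorentz.NonTimelikeLocallyIsolating (Set.univ : Set X₁) →
      Lorentz.NonTimelikeLocallyIsolating (Set.univ : Set X₂) →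
      Lorentz.StronglyCausal (Lorentz.Amalgam f)) ∧
    (Lorentz.StronglyCausal X₁ → Lorentz.StronglyCausal X₂ →
      Lorentz.NonTimelikeLocallyIsolating (Set.univ : Set X₁) →
      Lorentz.NonTimelikeLocallyIsolating (Set.univ : Set X₂) →
      Lorentz.Distinguishing X₁ → Lorentz.Distinguishing X₂ →
      Lorentz.Distinguishing (Lorentz.Amalgam f)) ∧
    (Lorentz.NoChronIsolatedPoints X₁ → Lorentz.NoChronIsolatedPoints X₂ →
      Lorentz.CausallyPathConnected X₁ → Lorentz.CausallyPathConnected X₂ →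
      Lorentz.LocallyCausallyClosed X₁ → Lorentz.LocallyCausallyClosed X₂ →
      Lorentz.DCompatible X₁ → Lorentz.DCompatible X₂ →
      Lorentz.GloballyHyperbolic X₁ → Lorentz.GloballyHyperbolic X₂ →
      Lorentz.TimeObserving A₁ → Lorentz.TimeObserving A₂ →
      Lorentz.GloballyHyperbolic (Lorentz.Amalgam f)) := by
  have h := hf.causalGluing
  have hA₁ := Lorentz.Amalgam.preimage_range_inr f.toEquiv
  have hA₂ := Lorentz.Amalgam.preimage_range_inl f.toEquiv
  refine ⟨h.chronological, h.causal, h.nonTotallyImprisoning, h.stronglyCausal, h.distinguishing,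
    fun I₁ I₂ P₁ P₂ L₁ L₂ _ _ G₁ G₂ T₁ T₂ => ?_⟩
  rw [← hA₁] at T₁
  rw [← hA₂] at T₂
  exact h.globallyHyperbolic I₁ I₂ P₁ P₂ L₁ L₂ G₁ G₂ T₁ T₂
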